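/- Let $k$ be a field and let $H=(H,\Delta,\varepsilon,\phi,S,\alpha,\beta)$ be a quasi-Hopf algebra over $k$ whose antipode $S$ is bijective. That is, $H$ is a $k$-algebra, $\Delta:H\to H\otimes H$ and $\varepsilon:H\to k$ are algebra maps, $\phi\in H^{\otimes3}$ is invertible, $S:H\to H$ is an anti-algebra map, $\alpha,\beta\in H$, and, writing $\Delta(h)=h_{(1)}\otimes h_{(2)}$, $\phi=\phi_1\otimes\phi_2\otimes\phi_3$, $\phi^{-1}=\bar\phi_1\otimes\bar\phi_2\otimes\bar\phi_3$ (sums suppressed), $$(\mathrm{id}\otimes\Delta)\Delta(h)=\phi\,(\Delta\otimes\mathrm{id})\Delta(h)\,\phi^{-1},\qquad \varepsilon(h_{(1)})h_{(2)}=h=h_{(1)}\varepsilon(h_{(2)}),$$ $$(\mathrm{id}\otimes\mathrm{id}\otimes\Delta)(\phi)\,(\Delta\otimes\mathrm{id}\otimes\mathrm{id})(\phi)=(1\otimes\phi)\,(\mathrm{id}\otimes\Delta\otimes\mathrm{id})(\phi)\,(\phi\otimes1),\qquad(\mathrm{id}\otimes\varepsilon\otimes\mathrm{id})(\phi)=1\otimes1,$$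 $$S(h_{(1)})\alpha h_{(2)}=\varepsilon(h)\alpha,\qquad h_{(1)}\beta S(h_{(2)})=\varepsilon(h)\beta,\qquad \phi_1\beta S(\phi_2)\alpha\phi_3=1=S(\bar\phi_1)\alpha\bar\phi_2\beta S(\bar\phi_3)$$ for all $h\in H$, and the normalization $\varepsilon(\alpha)=\varepsilon(\beta)=1$ holds. Put $q^{L}=S(\bar\phi_1)\alpha\bar\phi_2\otimes\bar\phi_3$ and $\mathbb b=\phi_{1(1)}\bar\phi_1\beta S(\phi_3)\otimes\phi_{1(2)}\bar\phi_2\beta S(\phi_2\bar\phi_3)$, let $$\bar f_1\otimes\bar f_2=\Delta(q^L_1)\,\mathbb b\,(S\otimes S)\Delta^{\mathrm{cop}}(q^L_2),\qquad \Delta^{\mathrm{cop}}(h)=h_{(2)}\otimes h_{(1)},$$ be the inverse of Drinfeld's twist, and set $\chi=(\phi\otimes1)\,(\Delta\otimes\mathrm{id}\otimes\mathrm{id})(\phi^{-1})\in H^{\otimes4}$ and $$\omega=(1\otimes1\otimes1\otimes\bar f_2\otimes\bar f_1)\cdot(\mathrm{id}\otimes\Delta\otimes S\otimes S)(\chi)\cdot(\phi\otimes1\otimes1)\in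 H^{\otimes5}.$$ Write $(\Delta\otimes\mathrm{id})\Delta(h)=h_{(1,1)}\otimes h_{(1,2)}\otimes h_{(2)}$. A Yetter–Drinfeld module of the second kind is a left $H$-module $V$ with a $k$-linear map $\delta_V:V\to H\otimes V$, $\delta_V(v)=v_{[-1]}\otimes v_{[0]}$, such that for all $h\in H$, $v\in V$ $$v_{[-1]}\otimes v_{[0][-1]}\otimes v_{[0][0]}=\omega_1(v_{[-1]})_{(1)}\omega_5\otimes\omega_2(v_{[-1]})_{(2)}\omega_4\otimes\omega_3v_{[0]},$$ $$\varepsilon(v_{[-1]})v_{[0]}=v,\qquad \delta_V(hv)=h_{(1,1)}v_{[-1]}S(h_{(2)})\otimes h_{(1,2)}v_{[0]}.$$ With the $H$-linear maps preserving the coactions as morphisms, these form a category ${}^H_H\mathcal{YD}$. Let $F:{}^H_H\mathcal{YD}\to{}_H\mathcal M$ be the forgetful functor to the category of left $H$-modules. For a left $H$-module $V$, let $R(V)=H\otimes V$ as a vector space, with $$h\triangleright(a\otimes v)=h_{(1,1)}aS(h_{(2)})\otimes h_{(1,2)}v,\qquad \delta_{R(V)}(a\otimes v)=\omega_1a_{(1)}\omega_5\otimes\omega_2a_{(2)}\omega_4\otimes\omega_3v.$$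 **Theorem.** For every left $H$-module $V$, $R(V)$ is a left $H$-module and a Yetter–Drinfeld module of the second kind, and $V\mapsto R(V)$, together with $f\mapsto\mathrm{id}_H\otimes f$ on morphisms, is a functor $R:{}_H\mathcal M\to{}^H_H\mathcal{YD}$. This functor is right adjoint to $F$, with unit and counit given by $$\eta_M:M\to RF(M),\quad m\mapsto m_{[-1]}\otimes m_{[0]}\qquad(M\in{}^H_H\mathcal{YD},\ m\in M),$$ $$\varepsilon_V:FR(V)\to V,\quad a\otimes v\mapsto\varepsilon(a)v\qquad(V\in{}_H\mathcal M,\ a\in H,\ v\in V).$$ -/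

import Mathlib

open scoped TensorProduct
open CategoryTheory
open scoped ModuleCat

universe w u v

set_option maxSynthPendingDepth 3

/-! Conventions: iterated tensor powers of `H` over `k` are bracketed to the right, so that
`H ⊗ H ⊗ H` is `H ⊗[k] (H ⊗[k] H)` and so on, with their componentwise algebra structures.
A left `H`-module is an object of `ModuleCat H`; its `k`-vector space structure is the one obtained
by restriction along `algebraMap k H`. -/

noncomputable section

namespace QuasiHopf

section TensorMaps

variable (k : Type w) [Field k] {H : Type u} [Ring H] [Algebra k H]

/-- The algebra map `x ⊗ y ↦ (x₁ ⊗ x₂) ⊗ y`, rebracketed, attached to an algebra map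
`x ↦ x₁ ⊗ x₂`. -/
def splitFirst {A : Type u} [Ring A] [Algebra k A] (D : H →ₐ[k] H ⊗[k] H) :
    H ⊗[k] A →ₐ[k] H ⊗[k] (H ⊗[k] A) :=
  (Algebra.TensorProduct.assoc k k k H H A).toAlgHom.comp
    (Algebra.TensorProduct.map D (AlgHom.id k A))

/-- `id ⊗ f` as an algebra map. -/
def onTail {A B : Type u} [Ring A] [Algebra k A] [Ring B] [Algebra k B] (f : A →ₐ[k] B) :
    H ⊗[k] A →ₐ[k] H ⊗[k] B :=
  Algebra.TensorProduct.map (AlgHom.id k H) f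

/-- The linear map `a ⊗ b ↦ f(a) g(b)` with values in an algebra `E`. -/
def contract {A B E : Type*} [AddCommGroup A] [Module k A] [AddCommGroup B] [Module k B]
    [Ring E] [Algebra k E] (f : A →ₗ[k] E) (g : B →ₗ[k] E) : A ⊗[k] B →ₗ[k] E :=
  LinearMap.mul' k E ∘ₗ TensorProduct.map f g

/-- `x ↦ x ⊗ 1`. -/
def padOne (A : Type u) [Ring A] [Algebra k A] : H →ₐ[k] H ⊗[k] A :=
  Algebra.TensorProduct.includeLeft

end TensorMaps

end QuasiHopf

open QuasiHopf in
/-- A quasi-Hopf algebra structure on the algebra `H` over the field `k`, normalized by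
`ε(α) = ε(β) = 1`. -/
structure QuasiHopfAlgebra (k : Type w) [Field k] (H : Type u) [Ring H] [Algebra k H] where
  /-- the comultiplication `Δ` -/
  comul : H →ₐ[k] H ⊗[k] H
  /-- the counit `ε` -/
  counit : H →ₐ[k] k
  /-- the associator `φ`, an invertible element of `H ⊗ H ⊗ H` -/
  phi : (H ⊗[k] (H ⊗[k] H))ˣ
  /-- the antipode `S`, an anti-algebra map -/
  antipode : H →ₗ[k] H
  /-- the element `α` -/
  alpha : H
  /-- the element `β` -/
  beta : H
  antipode_one : antipode 1 = 1
  antipode_mul : ∀ x y : H, antipode (x * y) = antipode y * antipode x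
  /-- `(id ⊗ Δ)Δ(h) = φ · (Δ ⊗ id)Δ(h) · φ⁻¹` -/
  coassoc : ∀ h : H,
    onTail k comul (comul h) =
      (phi : H ⊗[k] (H ⊗[k] H)) * splitFirst k comul (comul h) * (↑phi⁻¹ : H ⊗[k] (H ⊗[k] H))
  /-- `ε(h₁) h₂ = h` -/
  counit_left : ∀ h : H,
    TensorProduct.lid k H (TensorProduct.map counit.toLinearMap LinearMap.id (comul h)) = h
  /-- `h₁ ε(h₂) = h` -/
  counit_right : ∀ h : H,
    TensorProduct.rid k H (TensorProduct.map LinearMap.id counit.toLinearMap (comul h)) = h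
  /-- `(id ⊗ id ⊗ Δ)(φ) · (Δ ⊗ id ⊗ id)(φ) = (1 ⊗ φ) · (id ⊗ Δ ⊗ id)(φ) · (φ ⊗ 1)` -/
  pentagon :
    onTail k (onTail k comul) (phi : H ⊗[k] (H ⊗[k] H)) *
        splitFirst k comul (phi : H ⊗[k] (H ⊗[k] H)) =
      ((1 : H) ⊗ₜ[k] (phi : H ⊗[k] (H ⊗[k] H))) *
        onTail k (splitFirst k comul) (phi : H ⊗[k] (H ⊗[k] H)) *
        onTail k (onTail k (padOne k H)) (phi : H ⊗[k] (H ⊗[k] H))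
  /-- `(id ⊗ ε ⊗ id)(φ) = 1 ⊗ 1` -/
  phi_counit :
    TensorProduct.map (LinearMap.id : H →ₗ[k] H)
      ((TensorProduct.lid k H).toLinearMap ∘ₗ
        TensorProduct.map counit.toLinearMap LinearMap.id)
      (phi : H ⊗[k] (H ⊗[k] H)) = (1 : H) ⊗ₜ[k] (1 : H)
  /-- `S(h₁) α h₂ = ε(h) α` -/
  antipode_left : ∀ h : H,
    contract k antipode (LinearMap.mulLeft k alpha) (comul h) = counit h • alpha
  /-- `h₁ β S(h₂) = ε(h) β` -/
  antipode_right : ∀ h : H,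
    contract k LinearMap.id (LinearMap.mulLeft k beta ∘ₗ antipode) (comul h) = counit h • beta
  /-- `φ₁ β S(φ₂) α φ₃ = 1` -/
  zigzag_phi :
    contract k LinearMap.id
      (contract k (LinearMap.mulLeft k beta ∘ₗ antipode) (LinearMap.mulLeft k alpha))
      (phi : H ⊗[k] (H ⊗[k] H)) = 1
  /-- `S(φ̄₁) α φ̄₂ β S(φ̄₃) = 1`, where `φ̄ = φ⁻¹` -/
  zigzag_phi_inv :
    contract k antipode
      (contract k (LinearMap.mulLeft k alpha) (LinearMap.mulLeft k beta ∘ₗ antipode))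
      (↑phi⁻¹ : H ⊗[k] (H ⊗[k] H)) = 1
  counit_alpha : counit alpha = 1
  counit_beta : counit beta = 1

namespace QuasiHopfAlgebra

open QuasiHopf

variable {k : Type w} [Field k] {H : Type u} [Ring H] [Algebra k H] (Q : QuasiHopfAlgebra k H)

/-! ### The inverse of Drinfeld's twist -/

/-- `qᴸ = S(φ̄₁) α φ̄₂ ⊗ φ̄₃`, where `φ̄ = φ⁻¹`. -/
def qL : H ⊗[k] H :=
  TensorProduct.map
    (contract k Q.antipode (LinearMap.mulLeft k Q.alpha))
    LinearMap.id
    ((TensorProduct.assoc k H H H).symm (↑Q.phi⁻¹ : H ⊗[k] (H ⊗[k] H)))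

/-- `x ⊗ y ↦ x β S(y)`. -/
def betaContract : H ⊗[k] H →ₗ[k] H :=
  contract k LinearMap.id (LinearMap.mulLeft k Q.beta ∘ₗ Q.antipode)

/-- `x ⊗ y ⊗ z ⊗ t ↦ (x ⊗ t) ⊗ (y ⊗ z)`. -/
def nestPairs :
    H ⊗[k] (H ⊗[k] (H ⊗[k] H)) →ₗ[k] (H ⊗[k] H) ⊗[k] (H ⊗[k] H) :=
  (TensorProduct.assoc k H H (H ⊗[k] H)).symm.toLinearMap ∘ₗ
    TensorProduct.map LinearMap.id
      ((TensorProduct.comm k (H ⊗[k] H) H).toLinearMap ∘ₗ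
        (TensorProduct.assoc k H H H).symm.toLinearMap)

/-- `𝕓 = φ_{1(1)} φ̄₁ β S(φ₃) ⊗ φ_{1(2)} φ̄₂ β S(φ₂ φ̄₃)`, obtained from
`(Δ ⊗ id ⊗ id)(φ) · (φ⁻¹ ⊗ 1)` by `x ⊗ y ⊗ z ⊗ t ↦ x β S(t) ⊗ y β S(z)`. -/
def twistB : H ⊗[k] H :=
  TensorProduct.map Q.betaContract Q.betaContract
    (nestPairs
      (splitFirst k Q.comul (Q.phi : H ⊗[k] (H ⊗[k] H)) *
        onTail k (onTail k (padOne k H)) (↑Q.phi⁻¹ : H ⊗[k] (H ⊗[k] H))))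

/-- The inverse of Drinfeld's twist,
`𝕗⁻¹ = Δ(qᴸ₁) · 𝕓 · (S ⊗ S)(Δᶜᵒᵖ(qᴸ₂))`, where `Δᶜᵒᵖ(h) = h₂ ⊗ h₁`. -/
def twistInv : H ⊗[k] H :=
  contract k
    (LinearMap.mulRight k Q.twistB ∘ₗ Q.comul.toLinearMap)
    (TensorProduct.map Q.antipode Q.antipode ∘ₗ
      (TensorProduct.comm k H H).toLinearMap ∘ₗ Q.comul.toLinearMap)
    Q.qL

/-! ### The element `ω` -/

/-- `χ = (φ ⊗ 1) · (Δ ⊗ id ⊗ id)(φ⁻¹)`. -/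
def chi : H ⊗[k] (H ⊗[k] (H ⊗[k] H)) :=
  onTail k (onTail k (padOne k H)) (Q.phi : H ⊗[k] (H ⊗[k] H)) *
    splitFirst k Q.comul (↑Q.phi⁻¹ : H ⊗[k] (H ⊗[k] H))

/-- `ω = (1 ⊗ 1 ⊗ 1 ⊗ f̄₂ ⊗ f̄₁) · (id ⊗ Δ ⊗ S ⊗ S)(χ) · (φ ⊗ 1 ⊗ 1)`, where
`f̄₁ ⊗ f̄₂` is the inverse of Drinfeld's twist. -/
def omega : H ⊗[k] (H ⊗[k] (H ⊗[k] (H ⊗[k] H))) :=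
  ((1 : H) ⊗ₜ[k] ((1 : H) ⊗ₜ[k] ((1 : H) ⊗ₜ[k] TensorProduct.comm k H H Q.twistInv))) *
    TensorProduct.map (LinearMap.id : H →ₗ[k] H)
      ((TensorProduct.assoc k H H (H ⊗[k] H)).toLinearMap ∘ₗ
        TensorProduct.map Q.comul.toLinearMap (TensorProduct.map Q.antipode Q.antipode))
      Q.chi *
    onTail k (onTail k (padOne k (H ⊗[k] H))) (Q.phi : H ⊗[k] (H ⊗[k] H))

/-! ### The left `H`-module `H ⊳ V` -/

section Slots

variable (H) (M : Type*) [AddCommGroup M] [Module k M]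

/-- `x ↦ (a ⊗ m ↦ x a ⊗ m)`. -/
def mulLeftSlot : H →ₗ[k] Module.End k (H ⊗[k] M) :=
  LinearMap.rTensorHom M ∘ₗ LinearMap.mul k H

/-- `x ↦ (a ⊗ m ↦ a x ⊗ m)`. -/
def mulRightSlot : H →ₗ[k] Module.End k (H ⊗[k] M) :=
  LinearMap.rTensorHom M ∘ₗ (LinearMap.mul k H).flip

/-- `f ↦ (a ⊗ m ↦ a ⊗ f(m))`. -/
def tailSlot : Module.End k M →ₗ[k] Module.End k (H ⊗[k] M) :=
  LinearMap.lTensorHom H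

end Slots

section Action

variable (V : ModuleCat.{v} H)

/-- The action of `H` on `V` as a linear map `H → End_k(V)`. -/
def actionMap : H →ₗ[k] Module.End k V := (Algebra.lsmul k k V).toLinearMap

/-- The linear map `x ⊗ y ⊗ z ↦ (a ⊗ v ↦ x a S(z) ⊗ y v)`. -/
def sandwich : H ⊗[k] (H ⊗[k] H) →ₗ[k] Module.End k (H ⊗[k] V) :=
  contract k (mulLeftSlot H V)
    (contract k (tailSlot H V ∘ₗ actionMap V) (mulRightSlot H V ∘ₗ Q.antipode))

@[simp]
theorem sandwich_tmul (x y z a : H) (m : V) :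
    Q.sandwich V (x ⊗ₜ[k] (y ⊗ₜ[k] z)) (a ⊗ₜ[k] m) =
      (x * (a * Q.antipode z)) ⊗ₜ[k] (y • m) := by
  simp [sandwich, contract, mulLeftSlot, mulRightSlot, tailSlot, actionMap]

theorem sandwich_one : Q.sandwich V 1 = 1 := by
  ext a m
  simp [Algebra.TensorProduct.one_def, Q.antipode_one]

theorem sandwich_mul (s t : H ⊗[k] (H ⊗[k] H)) :
    Q.sandwich V (s * t) = Q.sandwich V s * Q.sandwich V t := by
  induction s with
  | zero => simp
  | add s₁ s₂ h₁ h₂ => simp only [add_mul, map_add, h₁, h₂]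
  | tmul x s =>
    induction s with
    | zero => simp
    | add s₁ s₂ h₁ h₂ => simp only [TensorProduct.tmul_add, add_mul, map_add, h₁, h₂]
    | tmul y z =>
      induction t with
      | zero => simp
      | add s₁ s₂ h₁ h₂ => simp only [mul_add, map_add, h₁, h₂]
      | tmul x' t =>
        induction t with
        | zero => simp
        | add s₁ s₂ h₁ h₂ => simp only [TensorProduct.tmul_add, mul_add, map_add, h₁, h₂]
        | tmul y' z' =>
          ext a m
          simp [Q.antipode_mul, mul_assoc, mul_smul]

/-- The action `h ▷ (a ⊗ v) = h_{(1,1)} a S(h₂) ⊗ h_{(1,2)} v` of `H` on `H ⊗ V`, where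
`h_{(1,1)} ⊗ h_{(1,2)} ⊗ h₂ = (Δ ⊗ id)Δ(h)`. -/
def adAction : H →ₐ[k] Module.End k (H ⊗[k] V) :=
  AlgHom.ofLinearMap
    (Q.sandwich V ∘ₗ (splitFirst k Q.comul).toLinearMap ∘ₗ Q.comul.toLinearMap)
    (by simp [sandwich_one]) (by simp [sandwich_mul])

/-- The underlying space of `R(V)`: a copy of `H ⊗ V` on which `H` acts by `Q.adAction V`. -/
def RadCarrier (_ : QuasiHopfAlgebra k H) (V : ModuleCat.{v} H) : Type (max u v) := H ⊗[k] V

instance : AddCommGroup (Q.RadCarrier V) := inferInstanceAs (AddCommGroup (H ⊗[k] V))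

instance : Module H (Q.RadCarrier V) where
  smul h t := (Q.adAction V h : H ⊗[k] V →ₗ[k] H ⊗[k] V) t
  one_smul t := congrArg (fun g : Module.End k (H ⊗[k] V) => g t) (map_one (Q.adAction V))
  mul_smul x y t :=
    congrArg (fun g : Module.End k (H ⊗[k] V) => g t) (map_mul (Q.adAction V) x y)
  smul_zero h := map_zero (Q.adAction V h)
  smul_add h s t := map_add (Q.adAction V h) s t
  add_smul x y t :=
    congrArg (fun g : Module.End k (H ⊗[k] V) => g t) (map_add (Q.adAction V) x y)
  zero_smul t := congrArg (fun g : Module.End k (H ⊗[k] V) => g t) (map_zero (Q.adAction V))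

/-- The left `H`-module `R(V) = H ⊳ V`: the space `H ⊗ V` with the action `Q.adAction V`. -/
def radObj : ModuleCat.{max u v} H := ModuleCat.of H (Q.RadCarrier V)

/-- The identity map `H ⊗ V → R(V)`. -/
def toRad : H ⊗[k] V ≃ₗ[k] Q.radObj V where
  toFun t := t
  invFun t := t
  left_inv _ := rfl
  right_inv _ := rfl
  map_add' _ _ := rfl
  map_smul' c t := by
    change c • t = Q.adAction V (algebraMap k H c) t
    simp [Algebra.algebraMap_eq_smul_one]

theorem smul_toRad (h : H) (t : H ⊗[k] V) :
    h • Q.toRad V t = Q.toRad V (Q.adAction V h t) := rfl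

/-! ### Yetter-Drinfeld modules of the second kind -/

/-- The linear map sending `p ⊗ q ⊗ r ⊗ s ⊗ t ∈ H^{⊗ 5}` to
`a ⊗ b ⊗ v ↦ p a t ⊗ q b s ⊗ r v`. -/
def fiveAct :
    H ⊗[k] (H ⊗[k] (H ⊗[k] (H ⊗[k] H))) →ₗ[k] Module.End k (H ⊗[k] (H ⊗[k] V)) :=
  contract k (mulLeftSlot H (H ⊗[k] V))
    (contract k (tailSlot H (H ⊗[k] V) ∘ₗ mulLeftSlot H V)
      (contract k (tailSlot H (H ⊗[k] V) ∘ₗ tailSlot H V ∘ₗ actionMap V)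
        (contract k (tailSlot H (H ⊗[k] V) ∘ₗ mulRightSlot H V)
          (mulRightSlot H (H ⊗[k] V)))))

theorem fiveAct_tmul (p q r s t a b : H) (m : V) :
    fiveAct (k := k) V (p ⊗ₜ[k] (q ⊗ₜ[k] (r ⊗ₜ[k] (s ⊗ₜ[k] t)))) (a ⊗ₜ[k] (b ⊗ₜ[k] m)) =
      (p * (a * t)) ⊗ₜ[k] ((q * (b * s)) ⊗ₜ[k] (r • m)) := by
  simp [fiveAct, contract, mulLeftSlot, mulRightSlot, tailSlot, actionMap]

/-- `a ⊗ v ↦ ω₁ a₁ ω₅ ⊗ ω₂ a₂ ω₄ ⊗ ω₃ v`, where `a₁ ⊗ a₂ = Δ(a)`. -/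
def omegaMap : H ⊗[k] V →ₗ[k] H ⊗[k] (H ⊗[k] V) :=
  fiveAct V Q.omega ∘ₗ (TensorProduct.assoc k H H V).toLinearMap ∘ₗ
    TensorProduct.map Q.comul.toLinearMap LinearMap.id

/-- The linear map `δ : V → H ⊗ V`, `δ(v) = v₋₁ ⊗ v₀`, makes the left `H`-module `V` into a
Yetter-Drinfeld module of the second kind. -/
structure IsYetterDrinfeld (V : ModuleCat.{v} H) (δ : V →ₗ[k] H ⊗[k] V) : Prop where
  /-- `v₋₁ ⊗ (v₀)₋₁ ⊗ (v₀)₀ = ω₁ (v₋₁)₁ ω₅ ⊗ ω₂ (v₋₁)₂ ω₄ ⊗ ω₃ v₀` -/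
  coassoc : ∀ m : V, TensorProduct.map LinearMap.id δ (δ m) = Q.omegaMap V (δ m)
  /-- `ε(v₋₁) v₀ = v` -/
  counit : ∀ m : V,
    TensorProduct.lid k V (TensorProduct.map Q.counit.toLinearMap LinearMap.id (δ m)) = m
  /-- `δ(h v) = h_{(1,1)} v₋₁ S(h₂) ⊗ h_{(1,2)} v₀` -/
  compat : ∀ (h : H) (m : V), δ (h • m) = Q.adAction V h (δ m)

end Action

/-- Yetter-Drinfeld modules of the second kind over the quasi-Hopf algebra. -/
structure YetterDrinfeld where
  /-- the underlying left `H`-module -/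
  obj : ModuleCat.{v} H
  /-- the coaction of the second kind -/
  coact : obj →ₗ[k] H ⊗[k] obj
  isYetterDrinfeld : Q.IsYetterDrinfeld obj coact

namespace YetterDrinfeld

variable {Q}

/-- Morphisms of Yetter-Drinfeld modules: `H`-linear maps `f` with
`f(v)₋₁ ⊗ f(v)₀ = v₋₁ ⊗ f(v₀)`. -/
@[ext]
structure Hom (M N : YetterDrinfeld.{w, u, v} Q) where
  /-- the underlying `H`-linear map -/
  hom : M.obj ⟶ N.obj
  comm : ∀ m : M.obj,
    N.coact (hom m) = TensorProduct.map LinearMap.id (hom.hom.restrictScalars k) (M.coact m)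

instance : Category (YetterDrinfeld.{w, u, v} Q) where
  Hom M N := Hom M N
  id M :=
    { hom := 𝟙 M.obj
      comm := fun m => by
        simp }
  comp {L M N} f g :=
    { hom := f.hom ≫ g.hom
      comm := fun m => by
        have : ((f.hom ≫ g.hom).hom.restrictScalars k) =
          (g.hom.hom.restrictScalars k) ∘ₗ (f.hom.hom.restrictScalars k) := rfl
        rw [this, ModuleCat.comp_apply, g.comm, f.comm, ← LinearMap.comp_apply,
          ← TensorProduct.map_comp, LinearMap.id_comp] }
  id_comp _ := rfl
  comp_id _ := rfl
  assoc _ _ _ := rfl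

end YetterDrinfeld

/-- The forgetful functor `F` from Yetter-Drinfeld modules of the second kind to left
`H`-modules. -/
def forget : YetterDrinfeld.{w, u, v} Q ⥤ ModuleCat.{v} H where
  obj M := M.obj
  map f := YetterDrinfeld.Hom.hom f

/-! ### The functor `R` -/

/-- The free coaction `a ⊗ v ↦ ω₁ a₁ ω₅ ⊗ ω₂ a₂ ω₄ ⊗ ω₃ v` on `R(V)`. -/
def radCoact (V : ModuleCat.{v} H) : Q.radObj V →ₗ[k] H ⊗[k] Q.radObj V :=
  TensorProduct.map LinearMap.id (Q.toRad V).toLinearMap ∘ₗ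
    Q.omegaMap V ∘ₗ (Q.toRad V).symm.toLinearMap

section Naturality

variable {V W : ModuleCat.{v} H} (f : V ⟶ W)

/-- `id ⊗ f : H ⊗ V → H ⊗ W`. -/
def idTensor : H ⊗[k] V →ₗ[k] H ⊗[k] W :=
  TensorProduct.map LinearMap.id (f.hom.restrictScalars k)

@[simp]
theorem idTensor_tmul (a : H) (m : V) :
    idTensor (k := k) f (a ⊗ₜ[k] m) = a ⊗ₜ[k] f m := rfl

theorem idTensor_sandwich (s : H ⊗[k] (H ⊗[k] H)) (t : H ⊗[k] V) :
    idTensor f (Q.sandwich V s t) = Q.sandwich W s (idTensor f t) := by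
  induction s with
  | zero => simp
  | add s₁ s₂ h₁ h₂ => simp only [map_add, LinearMap.add_apply, h₁, h₂]
  | tmul x s =>
    induction s with
    | zero => simp
    | add s₁ s₂ h₁ h₂ =>
      simp only [TensorProduct.tmul_add, map_add, LinearMap.add_apply, h₁, h₂]
    | tmul y z =>
      induction t with
      | zero => simp
      | add t₁ t₂ h₁ h₂ => simp only [map_add, h₁, h₂]
      | tmul a m => simp

theorem idTensor_fiveAct (s : H ⊗[k] (H ⊗[k] (H ⊗[k] (H ⊗[k] H)))) (t : H ⊗[k] (H ⊗[k] V)) :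
    TensorProduct.map LinearMap.id (idTensor f) (fiveAct V s t) =
      fiveAct W s (TensorProduct.map LinearMap.id (idTensor f) t) := by
  induction s with
  | zero => simp
  | add s₁ s₂ h₁ h₂ => simp only [map_add, LinearMap.add_apply, h₁, h₂]
  | tmul p s =>
  induction s with
  | zero => simp
  | add s₁ s₂ h₁ h₂ => simp only [TensorProduct.tmul_add, map_add, LinearMap.add_apply, h₁, h₂]
  | tmul q s =>
  induction s with
  | zero => simp
  | add s₁ s₂ h₁ h₂ => simp only [TensorProduct.tmul_add, map_add, LinearMap.add_apply, h₁, h₂]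
  | tmul r s =>
  induction s with
  | zero => simp
  | add s₁ s₂ h₁ h₂ => simp only [TensorProduct.tmul_add, map_add, LinearMap.add_apply, h₁, h₂]
  | tmul x y =>
  induction t with
  | zero => simp
  | add t₁ t₂ h₁ h₂ => simp only [map_add, h₁, h₂]
  | tmul a t =>
  induction t with
  | zero => simp
  | add t₁ t₂ h₁ h₂ => simp only [TensorProduct.tmul_add, map_add, h₁, h₂]
  | tmul b m => simp [fiveAct_tmul]

theorem idTensor_omegaMap (t : H ⊗[k] V) :
    TensorProduct.map LinearMap.id (idTensor f) (Q.omegaMap V t) =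
      Q.omegaMap W (idTensor f t) := by
  simp only [omegaMap, LinearMap.comp_apply, idTensor_fiveAct]
  congr 1
  induction t with
  | zero => simp
  | add t₁ t₂ h₁ h₂ => simp only [map_add, h₁, h₂]
  | tmul a m =>
    simp only [TensorProduct.map_tmul, idTensor_tmul, LinearMap.id_apply]
    generalize Q.comul.toLinearMap a = d
    induction d with
    | zero => simp
    | add d₁ d₂ h₁ h₂ => simp only [TensorProduct.add_tmul, map_add, h₁, h₂]
    | tmul x y => simp

/-- The `H`-linear map `R(f) = id ⊗ f : R(V) → R(W)`. -/
def radMap : Q.radObj V ⟶ Q.radObj W :=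
  ModuleCat.ofHom
    { toFun := fun t : Q.RadCarrier V => (idTensor f t : Q.RadCarrier W)
      map_add' := fun s t => map_add (idTensor (k := k) f) s t
      map_smul' := fun _ t => Q.idTensor_sandwich f _ t }

theorem radMap_toRad (t : H ⊗[k] V) :
    Q.radMap f (Q.toRad V t) = Q.toRad W (idTensor f t) := rfl

theorem radCoact_toRad (t : H ⊗[k] V) :
    Q.radCoact V (Q.toRad V t) =
      TensorProduct.map LinearMap.id (Q.toRad V).toLinearMap (Q.omegaMap V t) := rfl

theorem radCoact_radMap (t : Q.radObj V) :
    Q.radCoact W (Q.radMap f t) =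
      TensorProduct.map LinearMap.id ((Q.radMap f).hom.restrictScalars k) (Q.radCoact V t) := by
  obtain ⟨t, rfl⟩ := (Q.toRad V).surjective t
  rw [radMap_toRad, radCoact_toRad, radCoact_toRad, ← idTensor_omegaMap]
  generalize Q.omegaMap V t = y
  induction y with
  | zero => simp
  | add y₁ y₂ h₁ h₂ => simp only [map_add, h₁, h₂]
  | tmul a s => rfl

end Naturality

/-- Once every `R(V) = H ⊳ V` with its free coaction is known to be a Yetter-Drinfeld module of
the second kind, this is the functor `V ↦ R(V)`, `f ↦ id ⊗ f`. -/
def radFunctor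
    (hR : ∀ V : ModuleCat.{max u v} H, Q.IsYetterDrinfeld (Q.radObj V) (Q.radCoact V)) :
    ModuleCat.{max u v} H ⥤ YetterDrinfeld.{w, u, max u v} Q where
  obj V := ⟨Q.radObj V, Q.radCoact V, hR V⟩
  map f := ⟨Q.radMap f, Q.radCoact_radMap f⟩
  map_id V := by
    apply YetterDrinfeld.Hom.ext
    ext t
    exact congrArg (fun g : H ⊗[k] V →ₗ[k] H ⊗[k] V => g t) TensorProduct.map_id
  map_comp f g := by
    apply YetterDrinfeld.Hom.ext
    ext t
    exact congrArg (fun g => g t)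
      (TensorProduct.map_comp (R := k) LinearMap.id (g.hom.restrictScalars k) LinearMap.id
        (f.hom.restrictScalars k))

end QuasiHopfAlgebra

end

/-! Every place of a space `H ⊗ ⋯ ⊗ M` on which `H` can act (left multiplication, right
multiplication through `S`, a given action on `M`) is a multiplicative map from `H` to an
endomorphism algebra. Commuting maps of this kind behave like objects of a monoidal category. The
product is the convolution `f(x₁) g(x₂)`, `ε` is a strict unit, and `φ` evaluated on three of them
is an associator: it satisfies the pentagon and is natural for intertwining linear maps. Here `β` is
a coevaluation, since `x₁ β S(x₂) = ε(x) β` says that `β` is invariant under the left slot times the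
right slot; `α` gives an evaluation `absorb`; the zigzag axioms are the triangle identities.
Identities between elements with many legs thus become statements about bracketings.

In this language Drinfeld's twist enters only through the map `doubling`, `a ⊗ m ↦ Δ(a) 𝕗⁻¹ ⊗ m`. It
factors through insertion of `𝕓`, one associator and `absorb` (`doubling_eq`), which explains why it
splits the left slot into two left slots and the right slot into two right slots in the opposite
order. Since `1 = S(φ̄₁) α φ̄₂ β S(φ̄₃)`, a map that intertwines both multiplications is determined
by its values at `β` (`eq_of_intertwines_of_beta`). As `Δ(β) 𝕗⁻¹ = 𝕓` (`doubling_beta`), the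
coherence of the twist (`doubling_coherence`) reduces to a diagram of six objects.

The rest of `ω` is a product of three associators rebracketing `((ab)c)(de)` to `(a((bc)d))e`, and
the free coaction is this rebracketing after `doubling`. It is compatible with the action because it
carries `(L f) R` to `(L₁ ((L₂ f) R₂)) R₁`. It is coassociative because a seven-object coherence
(`omegaUnit_coherence`) leaves exactly the defect that `doubling_coherence` repairs. Applying `ε` to
either tensor factor turns slots into units and associators into `1`.

For the adjunction, the compatibility and coassociativity axioms of `M` say that the coaction is a
morphism `M → R(M)`. The triangle identities are `(ε ⊗ id) δ = id` for `M` and `(id ⊗ ε) δ = id` for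
the free coaction. -/

noncomputable section

/-! ### Multiplicative, commuting and intertwining linear maps -/

namespace QuasiHopf

variable {k : Type w} [Field k]

/-- The linear map `f` between algebras is multiplicative and unital. -/
class MulMap {B A : Type*} [Ring B] [Algebra k B] [Ring A] [Algebra k A] (f : B →ₗ[k] A) :
    Prop where
  one : f 1 = 1
  mul : ∀ x y, f (x * y) = f x * f y

/-- The values of `f` commute with the values of `g`. -/
class CommMaps {B C A : Type*} [AddCommGroup B] [Module k B] [AddCommGroup C] [Module k C]
    [Ring A] [Algebra k A] (f : B →ₗ[k] A) (g : C →ₗ[k] A) : Prop where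
  comm : ∀ x y, f x * g y = g y * f x

section Contract

variable {A B C D : Type*} [Ring A] [Algebra k A]

@[simp]
theorem contract_tmul [AddCommGroup B] [Module k B] [AddCommGroup C] [Module k C]
    (f : B →ₗ[k] A) (g : C →ₗ[k] A) (x : B) (y : C) :
    contract k f g (x ⊗ₜ[k] y) = f x * g y := rfl

/-- Commuting families are closed under contraction, so the hypotheses needed for nested
convolutions are found by instance search. -/
instance CommMaps.contract_right [AddCommGroup B] [Module k B] [AddCommGroup C] [Module k C]
    [AddCommGroup D] [Module k D] (f : B →ₗ[k] A) (g : C →ₗ[k] A) (h : D →ₗ[k] A)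
    [CommMaps f g] [CommMaps f h] : CommMaps f (contract k g h) where
  comm x t := by
    induction t with
    | zero => simp
    | add t₁ t₂ h₁ h₂ => simp only [map_add, mul_add, add_mul, h₁, h₂]
    | tmul y z =>
      rw [contract_tmul, ← mul_assoc, CommMaps.comm x y, mul_assoc, CommMaps.comm x z, mul_assoc]

instance CommMaps.contract_left [AddCommGroup B] [Module k B] [AddCommGroup C] [Module k C]
    [AddCommGroup D] [Module k D] (f : B →ₗ[k] A) (g : C →ₗ[k] A) (h : D →ₗ[k] A)
    [CommMaps f h] [CommMaps g h] : CommMaps (contract k f g) h where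
  comm t z := by
    induction t with
    | zero => simp
    | add t₁ t₂ h₁ h₂ => simp only [map_add, mul_add, add_mul, h₁, h₂]
    | tmul x y =>
      rw [contract_tmul, mul_assoc, CommMaps.comm y z, ← mul_assoc, CommMaps.comm x z, mul_assoc]

instance MulMap.contract [Ring B] [Algebra k B] [Ring C] [Algebra k C]
    (f : B →ₗ[k] A) (g : C →ₗ[k] A) [MulMap f] [MulMap g] [CommMaps f g] :
    MulMap (contract k f g) where
  one := by rw [Algebra.TensorProduct.one_def, contract_tmul, MulMap.one, MulMap.one, one_mul]
  mul s t := by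
    induction s with
    | zero => simp
    | add s₁ s₂ h₁ h₂ => simp only [add_mul, map_add, h₁, h₂]
    | tmul x y =>
      induction t with
      | zero => simp
      | add s₁ s₂ h₁ h₂ => simp only [mul_add, map_add, h₁, h₂]
      | tmul x' y' =>
        rw [Algebra.TensorProduct.tmul_mul_tmul, contract_tmul, contract_tmul, contract_tmul,
          MulMap.mul (f := f), MulMap.mul (f := g), mul_assoc, mul_assoc, ← mul_assoc (g y), ← CommMaps.comm x' y, mul_assoc]

end Contract

/-- The linear map `e` satisfies `e (f(x) m) = f'(x) e(m)`. -/
def Intertwines {B M N : Type*} [AddCommGroup B] [Module k B] [AddCommGroup M] [Module k M]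
    [AddCommGroup N] [Module k N] (e : M →ₗ[k] N) (f : B →ₗ[k] Module.End k M)
    (f' : B →ₗ[k] Module.End k N) : Prop :=
  ∀ x m, e (f x m) = f' x (e m)

section Intertwines

variable {B C M N P : Type*} [AddCommGroup B] [Module k B] [AddCommGroup C] [Module k C]
  [AddCommGroup M] [Module k M] [AddCommGroup N] [Module k N] [AddCommGroup P] [Module k P]

theorem Intertwines.contract {e : M →ₗ[k] N} {f : B →ₗ[k] Module.End k M}
    {f' : B →ₗ[k] Module.End k N} {g : C →ₗ[k] Module.End k M} {g' : C →ₗ[k] Module.End k N}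
    (hf : Intertwines e f f') (hg : Intertwines e g g') :
    Intertwines e (contract k f g) (contract k f' g') := by
  intro t m
  induction t with
  | zero => simp
  | add t₁ t₂ h₁ h₂ => simp only [map_add, LinearMap.add_apply, h₁, h₂]
  | tmul x y => simp only [contract_tmul, Module.End.mul_apply, hf x, hg y]

theorem Intertwines.comp {e : M →ₗ[k] N} {e' : N →ₗ[k] P} {f : B →ₗ[k] Module.End k M}
    {f' : B →ₗ[k] Module.End k N} {f'' : B →ₗ[k] Module.End k P}
    (h' : Intertwines e' f' f'') (h : Intertwines e f f') :
    Intertwines (e' ∘ₗ e) f f'' := fun x m => by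
  rw [LinearMap.comp_apply, LinearMap.comp_apply, h x, h' x]

theorem Intertwines.id (f : B →ₗ[k] Module.End k M) :
    Intertwines LinearMap.id f f := fun _ _ => rfl

theorem Intertwines.of_comm (f : B →ₗ[k] Module.End k M) (g : C →ₗ[k] Module.End k M)
    [CommMaps f g] (y : C) : Intertwines (g y) f f := fun x m =>
  (congrArg (fun a : Module.End k M => a m) (CommMaps.comm (f := f) (g := g) x y)).symm

theorem Intertwines.of_comm' (f : B →ₗ[k] Module.End k M) (g : C →ₗ[k] Module.End k M)
    [CommMaps g f] (y : C) : Intertwines (g y) f f := fun x m =>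
  congrArg (fun a : Module.End k M => a m) (CommMaps.comm (f := g) (g := f) y x)

end Intertwines

end QuasiHopf

namespace QuasiHopfAlgebra

open QuasiHopf

variable {k : Type w} [Field k] {H : Type u} [Ring H] [Algebra k H] (Q : QuasiHopfAlgebra k H)

/-! ### Convolution and the associator in an algebra -/

section Convolution

variable {A : Type*} [Ring A] [Algebra k A]

/-- The convolution `x ↦ f(x₁) g(x₂)`. -/
def conv (f g : H →ₗ[k] A) : H →ₗ[k] A := contract k f g ∘ₗ Q.comul.toLinearMap

theorem conv_apply (f g : H →ₗ[k] A) (x : H) :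
    Q.conv f g x = contract k f g (Q.comul x) := rfl

instance conv_mulMap (f g : H →ₗ[k] A) [MulMap f] [MulMap g] [CommMaps f g] :
    MulMap (Q.conv f g) where
  one := by
    change contract k f g (Q.comul 1) = 1
    rw [map_one, MulMap.one]
  mul x y := by
    change contract k f g (Q.comul (x * y)) = _
    rw [map_mul, MulMap.mul]
    rfl

instance conv_commMaps_right {B : Type*} [AddCommGroup B] [Module k B] (f : B →ₗ[k] A)
    (g h : H →ₗ[k] A) [CommMaps f g] [CommMaps f h] : CommMaps f (Q.conv g h) where
  comm x y := CommMaps.comm (f := f) (g := contract k g h) x (Q.comul y)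

instance conv_commMaps_left {B : Type*} [AddCommGroup B] [Module k B] (f g : H →ₗ[k] A)
    (h : B →ₗ[k] A) [CommMaps f h] [CommMaps g h] : CommMaps (Q.conv f g) h where
  comm x y := CommMaps.comm (f := contract k f g) (g := h) (Q.comul x) y

/-- The linear map `x ⊗ y ⊗ z ↦ f(x) g(y) h(z)`. -/
abbrev tri (f g h : H →ₗ[k] A) : H ⊗[k] (H ⊗[k] H) →ₗ[k] A :=
  contract k f (contract k g h)

theorem tri_onTail (f g h : H →ₗ[k] A) (t : H ⊗[k] H) :
    tri f g h (onTail k Q.comul t) = contract k f (Q.conv g h) t := by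
  induction t with
  | zero => simp
  | add t₁ t₂ h₁ h₂ => simp only [map_add, h₁, h₂]
  | tmul x y => rfl

theorem contract_splitFirst {B : Type u} [Ring B] [Algebra k B] (f g : H →ₗ[k] A)
    (h : B →ₗ[k] A) (t : H ⊗[k] B) :
    contract k f (contract k g h) (splitFirst k Q.comul t) = contract k (Q.conv f g) h t := by
  induction t with
  | zero => simp
  | add t₁ t₂ h₁ h₂ => simp only [map_add, h₁, h₂]
  | tmul x y =>
    change contract k f (contract k g h) (TensorProduct.assoc k H H B (Q.comul x ⊗ₜ y)) =
      contract k f g (Q.comul x) * h y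
    generalize Q.comul x = d
    induction d with
    | zero => simp
    | add d₁ d₂ h₁ h₂ => simp only [map_add, TensorProduct.add_tmul, add_mul, h₁, h₂]
    | tmul a b => simp [mul_assoc]

/-- The value of the associator under `x ⊗ y ⊗ z ↦ f(x) g(y) h(z)`, as a unit. -/
def assocUnit (f g h : H →ₗ[k] A) [MulMap f] [MulMap g] [MulMap h] [CommMaps f g] [CommMaps f h]
    [CommMaps g h] : Aˣ where
  val := tri f g h (Q.phi : H ⊗[k] (H ⊗[k] H))
  inv := tri f g h (↑Q.phi⁻¹ : H ⊗[k] (H ⊗[k] H))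
  val_inv := by rw [← MulMap.mul, Units.mul_inv, MulMap.one]
  inv_val := by rw [← MulMap.mul, Units.inv_mul, MulMap.one]

theorem assocUnit_val (f g h : H →ₗ[k] A) [MulMap f] [MulMap g] [MulMap h] [CommMaps f g]
    [CommMaps f h] [CommMaps g h] :
    (Q.assocUnit f g h : A) = tri f g h (Q.phi : H ⊗[k] (H ⊗[k] H)) := rfl

theorem assocUnit_inv_val (f g h : H →ₗ[k] A) [MulMap f] [MulMap g] [MulMap h] [CommMaps f g]
    [CommMaps f h] [CommMaps g h] :
    (↑(Q.assocUnit f g h)⁻¹ : A) = tri f g h (↑Q.phi⁻¹ : H ⊗[k] (H ⊗[k] H)) := rfl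

theorem conv_conv_mul_assocUnit (f g h : H →ₗ[k] A) [MulMap f] [MulMap g] [MulMap h]
    [CommMaps f g] [CommMaps f h] [CommMaps g h] (x : H) :
    Q.conv f (Q.conv g h) x * (Q.assocUnit f g h : A) =
      Q.assocUnit f g h * Q.conv (Q.conv f g) h x := by
  have h₁ : Q.conv f (Q.conv g h) x = tri f g h (onTail k Q.comul (Q.comul x)) :=
    (Q.tri_onTail f g h _).symm
  have h₂ : Q.conv (Q.conv f g) h x = tri f g h (splitFirst k Q.comul (Q.comul x)) :=
    (Q.contract_splitFirst f g h _).symm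
  rw [h₁, h₂, Q.coassoc]
  change tri f g h _ * tri f g h _ = tri f g h _ * tri f g h _
  rw [← MulMap.mul, ← MulMap.mul]
  simp [mul_assoc]

/-- The map `x ⊗ y ⊗ z ⊗ t ↦ f(x) g(y) h(z) l(t)` is multiplicative because the four maps commute;
it carries each factor of the pentagon for `φ` to an associator. -/
theorem assocUnit_pentagon (f g h l : H →ₗ[k] A) [MulMap f] [MulMap g] [MulMap h] [MulMap l]
    [CommMaps f g] [CommMaps f h] [CommMaps f l] [CommMaps g h] [CommMaps g l] [CommMaps h l] :
    Q.assocUnit f g (Q.conv h l) * Q.assocUnit (Q.conv f g) h l =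
      Q.assocUnit g h l * Q.assocUnit f (Q.conv g h) l * Q.assocUnit f g h := by
  have key := congrArg (contract k f (contract k g (contract k h l))) Q.pentagon
  rw [MulMap.mul, MulMap.mul, MulMap.mul] at key
  apply Units.ext
  change tri f g (Q.conv h l) _ * tri (Q.conv f g) h l _ =
    tri g h l _ * tri f (Q.conv g h) l _ * tri f g h _
  convert key using 2
  · generalize (Q.phi : H ⊗[k] (H ⊗[k] H)) = t
    induction t with
    | zero => simp
    | add t₁ t₂ h₁ h₂ => simp only [map_add, h₁, h₂]
    | tmul x t =>
      exact congrArg (f x * ·) (Q.tri_onTail g h l t).symm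
  · rw [contract_splitFirst]
  · congr 1
    · rw [contract_tmul, MulMap.one, one_mul]
    · generalize (Q.phi : H ⊗[k] (H ⊗[k] H)) = t
      induction t with
      | zero => simp
      | add t₁ t₂ h₁ h₂ => simp only [map_add, h₁, h₂]
      | tmul x t =>
        exact congrArg (f x * ·) (Q.contract_splitFirst g h l t).symm
  · generalize (Q.phi : H ⊗[k] (H ⊗[k] H)) = t
    induction t with
    | zero => simp
    | add t₁ t₂ h₁ h₂ => simp only [map_add, h₁, h₂]
    | tmul x t =>
      induction t with
      | zero => simp
      | add t₁ t₂ h₁ h₂ => simp only [map_add, TensorProduct.tmul_add, h₁, h₂]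
      | tmul y z => simp [onTail, padOne, MulMap.one]

/-- The trivial map `x ↦ ε(x) 1`. -/
def eps (A : Type*) [Ring A] [Algebra k A] : H →ₗ[k] A :=
  Algebra.linearMap k A ∘ₗ Q.counit.toLinearMap

theorem eps_apply (x : H) : Q.eps A x = algebraMap k A (Q.counit x) := rfl

instance eps_mulMap : MulMap (Q.eps A) where
  one := by simp [eps_apply]
  mul x y := by simp [eps_apply]

instance eps_commMaps_left {B : Type*} [AddCommGroup B] [Module k B] (f : B →ₗ[k] A) :
    CommMaps (Q.eps A) f where
  comm _ _ := Algebra.commutes _ _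

instance eps_commMaps_right {B : Type*} [AddCommGroup B] [Module k B] (f : B →ₗ[k] A) :
    CommMaps f (Q.eps A) where
  comm _ _ := (Algebra.commutes _ _).symm

@[simp]
theorem eps_conv (f : H →ₗ[k] A) : Q.conv (Q.eps A) f = f := by
  ext x
  conv_rhs => rw [← Q.counit_left x]
  change contract k _ f (Q.comul x) = _
  generalize Q.comul x = d
  induction d with
  | zero => simp
  | add d₁ d₂ h₁ h₂ => simp only [map_add, h₁, h₂]
  | tmul a b => simp [eps_apply, ← Algebra.smul_def]

@[simp]
theorem conv_eps (f : H →ₗ[k] A) : Q.conv f (Q.eps A) = f := by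
  ext x
  conv_rhs => rw [← Q.counit_right x]
  change contract k f _ (Q.comul x) = _
  generalize Q.comul x = d
  induction d with
  | zero => simp
  | add d₁ d₂ h₁ h₂ => simp only [map_add, h₁, h₂]
  | tmul a b => simp [eps_apply, ← Algebra.commutes, ← Algebra.smul_def]

@[simp]
theorem assocUnit_eps_mid (f h : H →ₗ[k] A) [MulMap f] [MulMap h] [CommMaps f h] :
    Q.assocUnit f (Q.eps A) h = 1 := by
  apply Units.ext
  have key := congrArg (contract k f h) Q.phi_counit
  rw [contract_tmul, MulMap.one, MulMap.one, one_mul] at key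
  rw [Units.val_one, ← key]
  change tri f _ h _ = _
  generalize (Q.phi : H ⊗[k] (H ⊗[k] H)) = t
  induction t with
  | zero => simp
  | add t₁ t₂ h₁ h₂ => simp only [map_add, h₁, h₂]
  | tmul x t =>
    induction t with
    | zero => simp
    | add t₁ t₂ h₁ h₂ => simp only [map_add, TensorProduct.tmul_add, h₁, h₂]
    | tmul y z => simp [eps_apply, ← Algebra.smul_def]

-- In the pentagon for `ε, ε, g, h` the associators with `ε` in the middle are `1`, and what remains
-- reads `u = u * u` in a group. The case of `ε` on the right is symmetric.
@[simp]
theorem assocUnit_eps_left (g h : H →ₗ[k] A) [MulMap g] [MulMap h] [CommMaps g h] :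
    Q.assocUnit (Q.eps A) g h = 1 := by
  have := Q.assocUnit_pentagon (Q.eps A) (Q.eps A) g h
  simpa using this

@[simp]
theorem assocUnit_eps_right (f g : H →ₗ[k] A) [MulMap f] [MulMap g] [CommMaps f g] :
    Q.assocUnit f g (Q.eps A) = 1 := by
  have := Q.assocUnit_pentagon f g (Q.eps A) (Q.eps A)
  simpa using this

end Convolution

end QuasiHopfAlgebra

namespace QuasiHopf

/-! ### Word problems behind the coherence diagrams -/

section GroupIdentities

variable {G : Type*} [Group G]

/-- Each `p` is a pentagon and each `n` a naturality square of the six-object diagram. Most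
relations serve to eliminate one letter; after that the two sides differ only by a free-group
computation. -/
theorem six_object_identity {x X y z u v w t d e f g h i j l m n o q r s a : G}
    (p₁ : z * i = u * v * j) (p₂ : X * l = d * m * n) (p₃ : w * j = t * o * q)
    (p₄ : q * y = h * r * x) (p₅ : f * s = g * a * r) (n₁ : i * y = y * l) (n₂ : e * x = x * m)
    (n₃ : s * x = x * n) (n₄ : o * h = h * a) (n₅ : d * x = x * d) :
    x * X * y⁻¹ * (z⁻¹ * u * v * w⁻¹ * t) = d * (e * f⁻¹ * (g * h⁻¹)) := by
  obtain rfl : l = y⁻¹ * (i * y) := by rw [n₁]; group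
  obtain rfl : m = x⁻¹ * (e * x) := by rw [n₂]; group
  obtain rfl : n = x⁻¹ * (s * x) := by rw [n₃]; group
  obtain rfl : o = h * a * h⁻¹ := by rw [← n₄]; group
  obtain rfl : f = g * a * r * s⁻¹ := by rw [← p₅]; group
  obtain rfl : r = h⁻¹ * (q * y) * x⁻¹ := by rw [p₄]; group
  obtain rfl : w = t * (h * a * h⁻¹) * q * j⁻¹ := by rw [← p₃]; group
  obtain rfl : z = u * v * j * i⁻¹ := by rw [← p₁]; group
  -- The relations `p₂` and `n₅` were not used for an elimination; together they rewrite `x * X`.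
  have hX : x * X = d * (e * s) * x * (y⁻¹ * (i * y))⁻¹ := by
    rw [eq_mul_inv_iff_mul_eq, mul_assoc, p₂]
    calc _ = x * d * x⁻¹ * (e * s) * x := by group
      _ = _ := by rw [← n₅]; group
  rw [hX]
  group

/-- Same method for the seven-object diagram. The letter `x` stands for an associator in the last
three slots, so `n₃`, `n₈` and `n₉` say that it commutes with associators in the earlier slots. -/
theorem seven_object_identity {A₁ A₂ A₃ B₁ B₂ B₃ C₁ C₂ C₃ D₁ D₂ D₃ x y q o s t v w z α β : G}
    (p₁ : q * D₃ = A₃ * B₃ * y) (p₂ : C₃ * D₁ = A₁ * o * q) (p₃ : s * t = A₂ * v * o)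
    (p₄ : w * z = x * α * t) (n₁ : s * A₃ = A₃ * B₁) (n₂ : α * A₃ = A₃ * B₂) (n₃ : x * y = y * x)
    (n₄ : w * q = q * D₂) (n₅ : C₁ * A₁ = A₁ * v) (n₆ : C₂ * A₁ = A₁ * β) (n₇ : β * o = o * z)
    (n₈ : x * D₃ = D₃ * x) (n₉ : x * q = q * x) :
    A₁ * A₂⁻¹ * A₃ * (B₁ * B₂⁻¹ * B₃) * (x⁻¹ * y) =
      C₁ * C₂⁻¹ * C₃ * (D₁ * D₂⁻¹ * D₃) := by
  have hxy : x⁻¹ * y = y * x⁻¹ := by rw [inv_mul_eq_iff_eq_mul, ← mul_assoc, n₃]; group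
  have hxq : x * (q * D₃) = q * D₃ * x := by rw [← mul_assoc, n₉, mul_assoc, n₈, mul_assoc]
  obtain rfl : B₁ = A₃⁻¹ * (s * A₃) := by rw [n₁]; group
  obtain rfl : B₂ = A₃⁻¹ * (α * A₃) := by rw [n₂]; group
  obtain rfl : D₂ = q⁻¹ * (w * q) := by rw [n₄]; group
  obtain rfl : C₁ = A₁ * v * A₁⁻¹ := by rw [← n₅]; group
  obtain rfl : C₂ = A₁ * β * A₁⁻¹ := by rw [← n₆]; group
  obtain rfl : β = o * z * o⁻¹ := by rw [← n₇]; group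
  obtain rfl : C₃ = A₁ * o * q * D₁⁻¹ := by rw [← p₂]; group
  obtain rfl : v = A₂⁻¹ * (s * t) * o⁻¹ := by rw [p₃]; group
  obtain rfl : w = x * α * t * z⁻¹ := by rw [← p₄]; group
  calc _ = A₁ * A₂⁻¹ * s * α⁻¹ * (A₃ * B₃ * y) * x⁻¹ := by rw [hxy]; group
    _ = A₁ * A₂⁻¹ * s * α⁻¹ * x⁻¹ * (x * (q * D₃)) * x⁻¹ := by rw [← p₁]; group
    _ = _ := by rw [hxq]; group

end GroupIdentities

end QuasiHopf

namespace QuasiHopfAlgebra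

open QuasiHopf

variable {k : Type w} [Field k] {H : Type u} [Ring H] [Algebra k H] (Q : QuasiHopfAlgebra k H)

/-! ### Naturality and coherence of the associator -/

section Naturality

variable {M N : Type*} [AddCommGroup M] [Module k M] [AddCommGroup N] [Module k N]

theorem intertwines_conv {e : M →ₗ[k] N} {f g : H →ₗ[k] Module.End k M}
    {f' g' : H →ₗ[k] Module.End k N} (hf : Intertwines e f f') (hg : Intertwines e g g') :
    Intertwines e (Q.conv f g) (Q.conv f' g') := fun x m =>
  hf.contract hg (Q.comul x) m

variable {f g h : H →ₗ[k] Module.End k M} [MulMap f] [MulMap g] [MulMap h] [CommMaps f g]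
  [CommMaps f h] [CommMaps g h] {f' g' h' : H →ₗ[k] Module.End k N} [MulMap f'] [MulMap g']
  [MulMap h'] [CommMaps f' g'] [CommMaps f' h'] [CommMaps g' h'] {e : M →ₗ[k] N}

/-- Naturality of the associator. The map `e` need not be invertible nor preserve the space, so
inserting `β`, applying `ε`, absorbing and doubling all count as morphisms. -/
theorem map_assocUnit (hf : Intertwines e f f') (hg : Intertwines e g g')
    (hh : Intertwines e h h') (m : M) :
    e ((Q.assocUnit f g h : Module.End k M) m) = (Q.assocUnit f' g' h' : Module.End k N) (e m) :=
  hf.contract (hg.contract hh) _ m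

theorem map_assocUnit_inv (hf : Intertwines e f f') (hg : Intertwines e g g')
    (hh : Intertwines e h h') (m : M) :
    e ((↑(Q.assocUnit f g h)⁻¹ : Module.End k M) m) =
      (↑(Q.assocUnit f' g' h')⁻¹ : Module.End k N) (e m) :=
  hf.contract (hg.contract hh) _ m

end Naturality

section Coherence

variable {M : Type*} [AddCommGroup M] [Module k M]

section

variable (f g h : H →ₗ[k] Module.End k M) [MulMap f] [MulMap g] [MulMap h] [CommMaps f g]
  [CommMaps f h] [CommMaps g h]

theorem assocUnit_intertwines :
    Intertwines (Q.assocUnit f g h : Module.End k M) (Q.conv (Q.conv f g) h)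
      (Q.conv f (Q.conv g h)) := fun x m =>
  (congrArg (fun a : Module.End k M => a m) (Q.conv_conv_mul_assocUnit f g h x)).symm

theorem assocUnit_intertwines_left {B : Type*} [AddCommGroup B] [Module k B]
    (s : B →ₗ[k] Module.End k M) [CommMaps s f] [CommMaps s g]
    [CommMaps s h] : Intertwines (Q.assocUnit f g h : Module.End k M) s s :=
  Intertwines.of_comm s (tri f g h) _

theorem assocUnit_intertwines_right {B : Type*} [AddCommGroup B] [Module k B]
    (s : B →ₗ[k] Module.End k M) [CommMaps f s] [CommMaps g s]
    [CommMaps h s] : Intertwines (Q.assocUnit f g h : Module.End k M) s s :=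
  Intertwines.of_comm' s (tri f g h) _

theorem assocUnit_inv_intertwines :
    Intertwines (↑(Q.assocUnit f g h)⁻¹ : Module.End k M) (Q.conv f (Q.conv g h))
      (Q.conv (Q.conv f g) h) := fun x m => by
  have := congrArg (fun a : Module.End k M => a m) <|
    (Units.eq_inv_mul_iff_mul_eq (Q.assocUnit f g h)).2 <| by
      rw [← mul_assoc, ← Q.conv_conv_mul_assocUnit f g h x, mul_assoc, Units.mul_inv, mul_one]
  exact this.symm

theorem assocUnit_inv_intertwines_left {B : Type*} [AddCommGroup B] [Module k B]
    (s : B →ₗ[k] Module.End k M) [CommMaps s f] [CommMaps s g] [CommMaps s h] :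
    Intertwines (↑(Q.assocUnit f g h)⁻¹ : Module.End k M) s s :=
  Intertwines.of_comm s (tri f g h) _

theorem assocUnit_inv_intertwines_right {B : Type*} [AddCommGroup B] [Module k B]
    (s : B →ₗ[k] Module.End k M) [CommMaps f s] [CommMaps g s] [CommMaps h s] :
    Intertwines (↑(Q.assocUnit f g h)⁻¹ : Module.End k M) s s :=
  Intertwines.of_comm' s (tri f g h) _

end

theorem assocUnit_mul_of_intertwines {f g h f' g' h' : H →ₗ[k] Module.End k M} [MulMap f]
    [MulMap g] [MulMap h] [CommMaps f g] [CommMaps f h] [CommMaps g h] [MulMap f'] [MulMap g']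
    [MulMap h'] [CommMaps f' g'] [CommMaps f' h'] [CommMaps g' h'] {e : (Module.End k M)ˣ}
    (hf : Intertwines (e : Module.End k M) f f') (hg : Intertwines (e : Module.End k M) g g')
    (hh : Intertwines (e : Module.End k M) h h') :
    Q.assocUnit f' g' h' * e = e * Q.assocUnit f g h := by
  apply Units.ext
  ext m
  exact (Q.map_assocUnit hf hg hh m).symm

/-- The element `ω` as an operator, without its factor given by Drinfeld's twist. -/
def omegaUnit (a b c d e : H →ₗ[k] Module.End k M) [MulMap a] [MulMap b] [MulMap c] [MulMap d]
    [MulMap e] [CommMaps a b] [CommMaps a c] [CommMaps a d] [CommMaps a e] [CommMaps b c]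
    [CommMaps b d] [CommMaps b e] [CommMaps c d] [CommMaps c e] [CommMaps d e] :
    (Module.End k M)ˣ :=
  Q.assocUnit a (Q.conv b c) d * (Q.assocUnit (Q.conv a (Q.conv b c)) d e)⁻¹ * Q.assocUnit a b c

section

variable (a b c d e f g : H →ₗ[k] Module.End k M) [MulMap a] [MulMap b] [MulMap c] [MulMap d]
  [MulMap e] [MulMap f] [CommMaps a b] [CommMaps a c] [CommMaps a d] [CommMaps a e]
  [CommMaps a f] [CommMaps b c] [CommMaps b d] [CommMaps b e] [CommMaps b f] [CommMaps c d]
  [CommMaps c e] [CommMaps c f] [CommMaps d e] [CommMaps d f] [CommMaps e f]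

/-- Two ways to reassociate `(a((b(cd))e))f` to `(a(bc))(d(ef))`. -/
theorem assocUnit_coherence_six :
    Q.assocUnit a b c * Q.assocUnit (Q.conv (Q.conv a b) c) d (Q.conv e f) *
        (Q.assocUnit (Q.conv a b) c d)⁻¹ *
        ((Q.assocUnit (Q.conv a b) (Q.conv c d) (Q.conv e f))⁻¹ *
          Q.assocUnit (Q.conv c d) e f * Q.assocUnit (Q.conv a b) (Q.conv (Q.conv c d) e) f *
          (Q.assocUnit a b (Q.conv (Q.conv c d) e))⁻¹ * Q.assocUnit b (Q.conv c d) e) =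
      Q.assocUnit d e f * (Q.assocUnit (Q.conv a (Q.conv b c)) (Q.conv d e) f *
        (Q.assocUnit a (Q.conv b c) (Q.conv d e))⁻¹ *
        (Q.assocUnit (Q.conv b c) d e * (Q.assocUnit b c d)⁻¹)) := by
  have p1 := Q.assocUnit_pentagon (Q.conv a b) (Q.conv c d) e f
  have p2 := Q.assocUnit_pentagon (Q.conv (Q.conv a b) c) d e f
  have p3 := Q.assocUnit_pentagon a b (Q.conv c d) e
  have p4 := Q.assocUnit_pentagon a b c d
  have p5 := Q.assocUnit_pentagon a (Q.conv b c) d e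
  have n1 := Q.assocUnit_mul_of_intertwines (Q.assocUnit_intertwines (Q.conv a b) c d)
    (Q.assocUnit_intertwines_right (Q.conv a b) c d e)
    (Q.assocUnit_intertwines_right (Q.conv a b) c d f)
  have n2 := Q.assocUnit_mul_of_intertwines (Q.assocUnit_intertwines a b c)
    (Q.assocUnit_intertwines_right a b c (Q.conv d e))
    (Q.assocUnit_intertwines_right a b c f)
  have n3 := Q.assocUnit_mul_of_intertwines (Q.assocUnit_intertwines a b c)
    (Q.assocUnit_intertwines_right a b c d)
    (Q.assocUnit_intertwines_right a b c e)
  have n4 := Q.assocUnit_mul_of_intertwines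
    (Q.assocUnit_intertwines_left b c d a) (Q.assocUnit_intertwines b c d)
    (Q.assocUnit_intertwines_right b c d e)
  -- The two associators live in disjoint slots, hence commute.
  have n5 := Q.assocUnit_mul_of_intertwines
    (Q.assocUnit_intertwines_right a b c d) (Q.assocUnit_intertwines_right a b c e)
    (Q.assocUnit_intertwines_right a b c f)
  exact six_object_identity p1 p2 p3 p4 p5 n1 n2 n3 n4 n5

variable [MulMap g] [CommMaps a g] [CommMaps b g] [CommMaps c g] [CommMaps d g] [CommMaps e g]
  [CommMaps f g]

/-- Two ways to reassociate `(((ab)c)d)(e(fg))` to `(a((b((cd)e))f))g`. -/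
theorem omegaUnit_coherence :
    Q.omegaUnit b c d e f * Q.omegaUnit a (Q.conv b c) d (Q.conv e f) g *
        ((Q.assocUnit e f g)⁻¹ * Q.assocUnit a b c) =
      Q.omegaUnit a b (Q.conv (Q.conv c d) e) f g *
        Q.omegaUnit (Q.conv a b) c d e (Q.conv f g) := by
  have p1 := Q.assocUnit_pentagon a b c d
  have p2 := Q.assocUnit_pentagon a b (Q.conv c d) e
  have p3 := Q.assocUnit_pentagon a (Q.conv b (Q.conv c d)) e f
  have p4 := Q.assocUnit_pentagon (Q.conv a (Q.conv b (Q.conv c d))) e f g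
  have n1 := Q.assocUnit_mul_of_intertwines
    (Q.assocUnit_intertwines_left b c d a) (Q.assocUnit_intertwines b c d)
    (Q.assocUnit_intertwines_right b c d (Q.conv e f))
  have n2 := Q.assocUnit_mul_of_intertwines
    (Q.intertwines_conv (Q.assocUnit_intertwines_left b c d a) (Q.assocUnit_intertwines b c d))
    (Q.assocUnit_intertwines_right b c d (Q.conv e f))
    (Q.assocUnit_intertwines_right b c d g)
  have n3 := Q.assocUnit_mul_of_intertwines
    (Q.assocUnit_intertwines_right a b c e) (Q.assocUnit_intertwines_right a b c f)
    (Q.assocUnit_intertwines_right a b c g)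
  have n4 := Q.assocUnit_mul_of_intertwines (Q.assocUnit_intertwines a b (Q.conv c d))
    (Q.assocUnit_intertwines_right a b (Q.conv c d) e)
    (Q.assocUnit_intertwines_right a b (Q.conv c d) (Q.conv f g))
  have n5 := Q.assocUnit_mul_of_intertwines
    (Q.assocUnit_intertwines_left b (Q.conv c d) e a) (Q.assocUnit_intertwines b (Q.conv c d) e)
    (Q.assocUnit_intertwines_right b (Q.conv c d) e f)
  have n6 := Q.assocUnit_mul_of_intertwines
    (Q.intertwines_conv (Q.assocUnit_intertwines_left b (Q.conv c d) e a)
      (Q.assocUnit_intertwines b (Q.conv c d) e))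
    (Q.assocUnit_intertwines_right b (Q.conv c d) e f)
    (Q.assocUnit_intertwines_right b (Q.conv c d) e g)
  have n7 := Q.assocUnit_mul_of_intertwines
    (Q.assocUnit_intertwines a (Q.conv b (Q.conv c d)) e)
    (Q.assocUnit_intertwines_right a (Q.conv b (Q.conv c d)) e f)
    (Q.assocUnit_intertwines_right a (Q.conv b (Q.conv c d)) e g)
  have n8 := Q.assocUnit_mul_of_intertwines
    (Q.assocUnit_intertwines_right (Q.conv a b) c d e)
    (Q.assocUnit_intertwines_right (Q.conv a b) c d f)
    (Q.assocUnit_intertwines_right (Q.conv a b) c d g)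
  have n9 := Q.assocUnit_mul_of_intertwines
    (Q.assocUnit_intertwines_right a b (Q.conv c d) e)
    (Q.assocUnit_intertwines_right a b (Q.conv c d) f)
    (Q.assocUnit_intertwines_right a b (Q.conv c d) g)
  exact seven_object_identity p1 p2 p3 p4 n1 n2 n3 n4 n5 n6 n7 n8 n9

end

end Coherence

/-! ### The slots of `H ⊗ M` -/

section Slots

variable (M : Type*) [AddCommGroup M] [Module k M]

/-- `x ↦ (a ⊗ m ↦ a S(x) ⊗ m)`. -/
def rightSlot : H →ₗ[k] Module.End k (H ⊗[k] M) := mulRightSlot H M ∘ₗ Q.antipode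

variable {M} in
/-- `x ↦ (a ⊗ m ↦ a ⊗ f(x) m)`. -/
def tail {B : Type*} [AddCommGroup B] [Module k B] (f : B →ₗ[k] Module.End k M) :
    B →ₗ[k] Module.End k (H ⊗[k] M) := tailSlot H M ∘ₗ f

@[simp]
theorem mulLeftSlot_tmul (x a : H) (m : M) :
    mulLeftSlot (k := k) H M x (a ⊗ₜ m) = (x * a) ⊗ₜ m := rfl

@[simp]
theorem rightSlot_tmul (x a : H) (m : M) :
    Q.rightSlot M x (a ⊗ₜ m) = (a * Q.antipode x) ⊗ₜ m := rfl

variable {M}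

section

variable {B : Type*} [AddCommGroup B] [Module k B] (f : B →ₗ[k] Module.End k M)

@[simp]
theorem tail_tmul (x : B) (a : H) (m : M) : tail f x (a ⊗ₜ m) = a ⊗ₜ f x m := rfl

instance : CommMaps (mulLeftSlot H M) (tail f : B →ₗ[k] Module.End k (H ⊗[k] M)) where
  comm x y := by ext; simp

instance : CommMaps (tail f : B →ₗ[k] Module.End k (H ⊗[k] M)) (mulLeftSlot H M) where
  comm x y := by ext; simp

instance : CommMaps (Q.rightSlot M) (tail f) where
  comm x y := by ext; simp

instance : CommMaps (tail f) (Q.rightSlot M) where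
  comm x y := by ext; simp

instance {C : Type*} [AddCommGroup C] [Module k C] (g : C →ₗ[k] Module.End k M) [CommMaps f g] :
    CommMaps (tail f : B →ₗ[k] Module.End k (H ⊗[k] M)) (tail g) where
  comm x y := by
    ext a m
    have : f x (g y m) = g y (f x m) :=
      congrArg (fun e : Module.End k M => e m) (CommMaps.comm (f := f) (g := g) x y)
    simp [this]

end

instance {B : Type*} [Ring B] [Algebra k B] (f : B →ₗ[k] Module.End k M) [MulMap f] :
    MulMap (tail f : B →ₗ[k] Module.End k (H ⊗[k] M)) where
  one := by ext; simp [MulMap.one (f := f)]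
  mul x y := by ext; simp [MulMap.mul (f := f)]

instance : MulMap (mulLeftSlot (k := k) H M) where
  one := by ext; simp
  mul x y := by ext; simp [mul_assoc]

instance : MulMap (Q.rightSlot M) where
  one := by ext; simp [Q.antipode_one]
  mul x y := by ext; simp [mul_assoc, Q.antipode_mul]

instance : CommMaps (mulLeftSlot H M) (Q.rightSlot M) where
  comm x y := by ext; simp [mul_assoc]

instance : CommMaps (Q.rightSlot M) (mulLeftSlot H M) where
  comm x y := by ext; simp [mul_assoc]

theorem tail_conv (f g : H →ₗ[k] Module.End k M) :
    (tail (Q.conv f g) : H →ₗ[k] Module.End k (H ⊗[k] M)) = Q.conv (tail f) (tail g) := by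
  ext x a m
  change a ⊗ₜ[k] contract k f g (Q.comul x) m =
    contract k (tail (H := H) f) (tail (H := H) g) (Q.comul x) (a ⊗ₜ[k] m)
  generalize Q.comul x = d
  induction d with
  | zero => simp
  | add d₁ d₂ h₁ h₂ => simp only [map_add, LinearMap.add_apply, TensorProduct.tmul_add, h₁, h₂]
  | tmul y z => simp

theorem tail_eps :
    (tail (Q.eps (Module.End k M)) : H →ₗ[k] Module.End k (H ⊗[k] M)) = Q.eps _ := by
  ext x a m
  simp [eps_apply, Module.algebraMap_end_apply]

end Slots

/-! ### Intertwiners between the slots -/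

section SlotIntertwiners

variable {M N : Type*} [AddCommGroup M] [Module k M] [AddCommGroup N] [Module k N]

theorem lTensor_intertwines_left (e : M →ₗ[k] N) :
    Intertwines (e.lTensor H) (mulLeftSlot H M) (mulLeftSlot H N) := fun x t => by
  induction t with
  | zero => simp
  | add t₁ t₂ h₁ h₂ => simp only [map_add, h₁, h₂]
  | tmul a m => simp

theorem lTensor_intertwines_right (e : M →ₗ[k] N) :
    Intertwines (e.lTensor H) (Q.rightSlot M) (Q.rightSlot N) := fun x t => by
  induction t with
  | zero => simp
  | add t₁ t₂ h₁ h₂ => simp only [map_add, h₁, h₂]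
  | tmul a m => simp

theorem lTensor_intertwines_tail {B : Type*} [AddCommGroup B] [Module k B] {e : M →ₗ[k] N}
    {f : B →ₗ[k] Module.End k M} {f' : B →ₗ[k] Module.End k N} (h : Intertwines e f f') :
    Intertwines (e.lTensor H) (tail f) (tail f') := fun x t => by
  induction t with
  | zero => simp
  | add t₁ t₂ h₁ h₂ => simp only [map_add, h₁, h₂]
  | tmul a m => simp [h x m]

/-- `m ↦ β ⊗ m`. -/
def betaTmul (M : Type*) [AddCommGroup M] [Module k M] : M →ₗ[k] H ⊗[k] M :=
  TensorProduct.mk k H M Q.beta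

@[simp]
theorem betaTmul_apply (m : M) : Q.betaTmul M m = Q.beta ⊗ₜ m := rfl

theorem betaTmul_intertwines {B : Type*} [AddCommGroup B] [Module k B]
    (f : B →ₗ[k] Module.End k M) : Intertwines (Q.betaTmul M) f (tail f) := fun _ _ => rfl

/-- The axiom `x₁ β S(x₂) = ε(x) β` read as invariance of `β`: insertion of `β` is a morphism from
the unit object. -/
theorem betaTmul_intertwines_eps :
    Intertwines (Q.betaTmul M) (Q.eps _) (Q.conv (mulLeftSlot H M) (Q.rightSlot M)) :=
    fun x m => by
  have h := congrArg (· ⊗ₜ[k] m) (Q.antipode_right x)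
  simp only [betaTmul_apply, eps_apply, Module.algebraMap_end_apply, TensorProduct.tmul_smul]
  rw [TensorProduct.smul_tmul', ← h]
  change _ = contract k (mulLeftSlot H M) (Q.rightSlot M) (Q.comul x) (Q.beta ⊗ₜ[k] m)
  generalize Q.comul x = d
  induction d with
  | zero => simp
  | add d₁ d₂ h₁ h₂ => simp only [map_add, LinearMap.add_apply, TensorProduct.add_tmul, h₁, h₂]
  | tmul y z => simp

/-- `a ⊗ m ↦ ε(a) m`. -/
def counitTmul (M : Type*) [AddCommGroup M] [Module k M] : H ⊗[k] M →ₗ[k] M :=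
  (TensorProduct.lid k M).toLinearMap ∘ₗ TensorProduct.map Q.counit.toLinearMap LinearMap.id

@[simp]
theorem counitTmul_tmul (a : H) (m : M) : Q.counitTmul M (a ⊗ₜ m) = Q.counit a • m := rfl

/-- Apply `ε` to `S(x₁) α x₂ = ε(x) α` and use `ε(α) = 1`. -/
theorem counit_antipode (x : H) : Q.counit (Q.antipode x) = Q.counit x := by
  have h := congrArg Q.counit (Q.antipode_left x)
  rw [map_smul, Q.counit_alpha, smul_eq_mul, mul_one] at h
  rw [← h]
  conv_lhs => rw [← Q.counit_right x]
  generalize Q.comul x = d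
  induction d with
  | zero => simp
  | add d₁ d₂ h₁ h₂ => simp only [map_add, h₁, h₂]
  | tmul a b => simp [Q.counit_alpha, mul_comm]

theorem counitTmul_intertwines_left :
    Intertwines (Q.counitTmul M) (mulLeftSlot H M) (Q.eps _) := fun x t => by
  induction t with
  | zero => simp
  | add t₁ t₂ h₁ h₂ => simp only [map_add, h₁, h₂]
  | tmul a m => simp [eps_apply, Module.algebraMap_end_apply, mul_smul, smul_comm (Q.counit x)]

theorem counitTmul_intertwines_right :
    Intertwines (Q.counitTmul M) (Q.rightSlot M) (Q.eps _) := fun x t => by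
  induction t with
  | zero => simp
  | add t₁ t₂ h₁ h₂ => simp only [map_add, h₁, h₂]
  | tmul a m =>
    simp [eps_apply, Module.algebraMap_end_apply, counit_antipode, mul_smul]

theorem counitTmul_intertwines_tail {B : Type*} [AddCommGroup B] [Module k B]
    (f : B →ₗ[k] Module.End k M) : Intertwines (Q.counitTmul M) (tail f) f := fun x t => by
  induction t with
  | zero => simp
  | add t₁ t₂ h₁ h₂ => simp only [map_add, h₁, h₂]
  | tmul a m => simp

/-- Two maps out of `H ⊗ M` that intertwine left and right multiplications in the same way agree
as soon as they agree on `β ⊗ M`. -/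
theorem eq_of_intertwines_of_beta {X Y : H ⊗[k] M →ₗ[k] N} {D T : H →ₗ[k] Module.End k N}
    (hXL : Intertwines X (mulLeftSlot H M) D) (hYL : Intertwines Y (mulLeftSlot H M) D)
    (hXR : Intertwines X (Q.rightSlot M) T) (hYR : Intertwines Y (Q.rightSlot M) T)
    (hβ : ∀ m, X (Q.beta ⊗ₜ m) = Y (Q.beta ⊗ₜ m)) : X = Y := by
  have key : ∀ a b m, X ((a * (Q.beta * Q.antipode b)) ⊗ₜ m) =
      Y ((a * (Q.beta * Q.antipode b)) ⊗ₜ m) := fun a b m => by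
    rw [← mulLeftSlot_tmul, ← rightSlot_tmul, hXL, hXR, hYL, hYR, hβ]
  -- For `s = φ⁻¹` the contracted factor is `1`, so every `a` is a sum of elements of the shape
  -- treated in `key`.
  have key' : ∀ (a : H) (s : H ⊗[k] (H ⊗[k] H)) (m : M),
      X ((a * contract k Q.antipode (contract k (LinearMap.mulLeft k Q.alpha)
        (LinearMap.mulLeft k Q.beta ∘ₗ Q.antipode)) s) ⊗ₜ m) =
      Y ((a * contract k Q.antipode (contract k (LinearMap.mulLeft k Q.alpha)
        (LinearMap.mulLeft k Q.beta ∘ₗ Q.antipode)) s) ⊗ₜ m) := fun a s m => by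
    induction s with
    | zero => simp
    | add s₁ s₂ h₁ h₂ => simp only [map_add, mul_add, TensorProduct.add_tmul, h₁, h₂]
    | tmul x s =>
      induction s with
      | zero => simp
      | add s₁ s₂ h₁ h₂ =>
        simp only [map_add, mul_add, TensorProduct.tmul_add, TensorProduct.add_tmul, h₁, h₂]
      | tmul y z =>
        have := key (a * (Q.antipode x * (Q.alpha * y))) z m
        simpa [mul_assoc] using this
  ext a m
  have := key' a (↑Q.phi⁻¹) m
  rw [Q.zigzag_phi_inv, mul_one] at this
  exact this

end SlotIntertwiners

/-! ### Absorbing a slot with the help of `α` -/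

section Absorb

variable {W : Type*} [AddCommGroup W] [Module k W] (D : H →ₗ[k] Module.End k W)

/-- `c ⊗ m ↦ D(c α) m`. -/
def absorb : H ⊗[k] W →ₗ[k] W := TensorProduct.lift (D ∘ₗ LinearMap.mulRight k Q.alpha)

@[simp]
theorem absorb_tmul (c : H) (m : W) : Q.absorb D (c ⊗ₜ m) = D (c * Q.alpha) m := rfl

theorem absorb_intertwines_left [MulMap D] :
    Intertwines (Q.absorb D) (mulLeftSlot H W) D := fun x t => by
  induction t with
  | zero => simp
  | add t₁ t₂ h₁ h₂ => simp only [map_add, h₁, h₂]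
  | tmul a m => simp [mul_assoc, MulMap.mul (f := D)]

theorem absorb_intertwines_tail {B : Type*} [AddCommGroup B] [Module k B]
    (f : B →ₗ[k] Module.End k W) [CommMaps D f] :
    Intertwines (Q.absorb D) (tail f) f := fun x t => by
  induction t with
  | zero => simp
  | add t₁ t₂ h₁ h₂ => simp only [map_add, h₁, h₂]
  | tmul a m =>
    exact congrArg (fun e : Module.End k W => e m) (CommMaps.comm (f := D) (g := f) _ x)

/-- The axiom `S(x₁) α x₂ = ε(x) α` makes `absorb` an evaluation that contracts a right slot against
the action `D`. -/
theorem absorb_intertwines_eps [MulMap D] :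
    Intertwines (Q.absorb D) (Q.conv (Q.rightSlot W) (tail D)) (Q.eps _) := fun x t => by
  induction t with
  | zero => simp
  | add t₁ t₂ h₁ h₂ => simp only [map_add, h₁, h₂]
  | tmul a m =>
    have h := congrArg (fun b => D (a * b) m) (Q.antipode_left x)
    simp only [mul_smul_comm, map_smul, LinearMap.smul_apply] at h
    rw [absorb_tmul, eps_apply, Module.algebraMap_end_apply, ← h]
    change Q.absorb D (contract k (Q.rightSlot W) (tail D) (Q.comul x) (a ⊗ₜ[k] m)) = _
    generalize Q.comul x = d
    induction d with
    | zero => simp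
    | add d₁ d₂ h₁ h₂ => simp only [map_add, LinearMap.add_apply, mul_add, h₁, h₂]
    | tmul y z => simp [← mul_assoc, MulMap.mul (f := D)]

/-- Triangle identity for this evaluation and the insertion of `β`; it is `φ₁ β S(φ₂) α φ₃ = 1`
acting through `D`. -/
theorem absorb_assocUnit [MulMap D] (m : W) :
    Q.absorb D ((Q.assocUnit (mulLeftSlot H W) (Q.rightSlot W) (tail D) :
      Module.End k (H ⊗[k] W)) (Q.beta ⊗ₜ m)) = m := by
  have h := congrArg (fun b => D b m) Q.zigzag_phi
  simp only [MulMap.one (f := D), Module.End.one_apply] at h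
  conv_rhs => rw [← h]
  rw [assocUnit_val]
  generalize (Q.phi : H ⊗[k] (H ⊗[k] H)) = s
  induction s with
  | zero => simp
  | add s₁ s₂ h₁ h₂ => simp only [map_add, LinearMap.add_apply, h₁, h₂]
  | tmul x s =>
    induction s with
    | zero => simp
    | add s₁ s₂ h₁ h₂ =>
      simp only [map_add, TensorProduct.tmul_add, LinearMap.add_apply, h₁, h₂]
    | tmul y z => simp [mul_assoc, MulMap.mul (f := D)]

end Absorb

/-! ### The doubling map attached to Drinfeld's twist -/

section Doubling

variable (M : Type*) [AddCommGroup M] [Module k M]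

/-- `x ↦ (a ⊗ b ⊗ m ↦ x₁ a ⊗ x₂ b ⊗ m)`. -/
abbrev leftPair : H →ₗ[k] Module.End k (H ⊗[k] (H ⊗[k] M)) :=
  Q.conv (mulLeftSlot H (H ⊗[k] M)) (tail (mulLeftSlot H M))

/-- `x ↦ (a ⊗ b ⊗ m ↦ a S(x₂) ⊗ b S(x₁) ⊗ m)`. -/
abbrev rightPair : H →ₗ[k] Module.End k (H ⊗[k] (H ⊗[k] M)) :=
  Q.conv (tail (Q.rightSlot M)) (Q.rightSlot (H ⊗[k] M))

/-- `m ↦ 𝕓₁ ⊗ 𝕓₂ ⊗ m`. -/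
def twistBTmul : M →ₗ[k] H ⊗[k] (H ⊗[k] M) :=
  (↑(Q.assocUnit (Q.leftPair M) (tail (Q.rightSlot M)) (Q.rightSlot (H ⊗[k] M))) :
      Module.End k (H ⊗[k] (H ⊗[k] M))) ∘ₗ
    (↑(Q.assocUnit (mulLeftSlot H (H ⊗[k] M)) (tail (mulLeftSlot H M))
      (tail (Q.rightSlot M)))⁻¹ : Module.End k (H ⊗[k] (H ⊗[k] M))) ∘ₗ
    (Q.betaTmul M).lTensor H ∘ₗ Q.betaTmul M

/-- `a ⊗ m ↦ Δ(a) 𝕗⁻¹ ⊗ m`, where `𝕗⁻¹` is the inverse of Drinfeld's twist. -/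
def doubling : H ⊗[k] M →ₗ[k] H ⊗[k] (H ⊗[k] M) :=
  (TensorProduct.assoc k H H M).toLinearMap ∘ₗ
    (LinearMap.mulRight k Q.twistInv ∘ₗ Q.comul.toLinearMap).rTensor M

variable {M}

/-- On `β ⊗ β ⊗ m` the four slots produce `x β S(t) ⊗ y β S(z) ⊗ m`, with the second pair nested
inside the first; this is the pattern of `𝕓`. -/
theorem contract_nestPairs (s : H ⊗[k] (H ⊗[k] (H ⊗[k] H))) (m : M) :
    contract k (mulLeftSlot H (H ⊗[k] M)) (contract k (tail (mulLeftSlot H M))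
      (contract k (tail (Q.rightSlot M)) (Q.rightSlot (H ⊗[k] M)))) s
        (Q.beta ⊗ₜ[k] (Q.beta ⊗ₜ[k] m)) =
      TensorProduct.assoc k H H M
        (TensorProduct.map Q.betaContract Q.betaContract (nestPairs s) ⊗ₜ m) := by
  induction s with
  | zero => simp
  | add s₁ s₂ h₁ h₂ => simp only [map_add, LinearMap.add_apply, TensorProduct.add_tmul, h₁, h₂]
  | tmul x s =>
  induction s with
  | zero => simp
  | add s₁ s₂ h₁ h₂ =>
    simp only [TensorProduct.tmul_add, map_add, LinearMap.add_apply, TensorProduct.add_tmul,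
      h₁, h₂]
  | tmul y s =>
  induction s with
  | zero => simp
  | add s₁ s₂ h₁ h₂ =>
    simp only [TensorProduct.tmul_add, map_add, LinearMap.add_apply, TensorProduct.add_tmul,
      h₁, h₂]
  | tmul z t => simp [nestPairs, betaContract]

theorem contract_padOne {A : Type*} [Ring A] [Algebra k A] (f g h l : H →ₗ[k] A) [MulMap l]
    (s : H ⊗[k] (H ⊗[k] H)) :
    contract k f (contract k g (contract k h l)) (onTail k (onTail k (padOne k H)) s) =
      tri f g h s := by
  induction s with
  | zero => simp
  | add t₁ t₂ h₁ h₂ => simp only [map_add, h₁, h₂]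
  | tmul x t =>
    induction t with
    | zero => simp
    | add t₁ t₂ h₁ h₂ => simp only [map_add, TensorProduct.tmul_add, h₁, h₂]
    | tmul y z => simp [onTail, padOne, MulMap.one]

theorem twistBTmul_apply (m : M) :
    Q.twistBTmul M m = TensorProduct.assoc k H H M (Q.twistB ⊗ₜ m) := by
  rw [twistB, ← contract_nestPairs, MulMap.mul, contract_splitFirst, contract_padOne]
  rfl

theorem twistBTmul_intertwines {B : Type*} [AddCommGroup B] [Module k B]
    (f : B →ₗ[k] Module.End k M) : Intertwines (Q.twistBTmul M) f (tail (tail f)) := by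
  rw [twistBTmul]
  refine (Q.assocUnit_intertwines_right (Q.leftPair M) (tail (Q.rightSlot M))
    (Q.rightSlot (H ⊗[k] M)) (tail (tail f))).comp ?_
  refine (Q.assocUnit_inv_intertwines_right (mulLeftSlot H (H ⊗[k] M)) (tail (mulLeftSlot H M))
    (tail (Q.rightSlot M)) (tail (tail f))).comp ?_
  exact (lTensor_intertwines_tail (Q.betaTmul_intertwines f)).comp (Q.betaTmul_intertwines f)

/-- `𝕓` is one `β` nested inside another, so it is invariant under `L₁ (L₂ R₂)` followed by `R₁`.
The two associators in its definition rebracket this as `(L₁ L₂)(R₂ R₁)`. -/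
theorem twistBTmul_intertwines_eps :
    Intertwines (Q.twistBTmul M) (Q.eps _) (Q.conv (Q.leftPair M) (Q.rightPair M)) := by
  refine (Q.assocUnit_intertwines _ _ _).comp <|
    (Q.intertwines_conv (Q.assocUnit_inv_intertwines _ _ _)
      (Q.assocUnit_inv_intertwines_right _ _ _ _)).comp <|
    Intertwines.comp (f' := Q.conv (mulLeftSlot H M) (Q.rightSlot M)) ?_
      Q.betaTmul_intertwines_eps
  have h := lTensor_intertwines_tail (H := H) (Q.betaTmul_intertwines_eps (M := M))
  rw [tail_conv, tail_eps] at h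
  have := Q.intertwines_conv
    (Q.intertwines_conv (lTensor_intertwines_left (Q.betaTmul M)) h)
    (Q.lTensor_intertwines_right (Q.betaTmul M))
  rwa [conv_eps] at this

theorem leftPair_assoc (x : H) (t : H ⊗[k] H) (m : M) :
    Q.leftPair M x (TensorProduct.assoc k H H M (t ⊗ₜ m)) =
      TensorProduct.assoc k H H M ((Q.comul x * t) ⊗ₜ m) := by
  rw [leftPair, conv_apply]
  generalize Q.comul x = d
  induction d with
  | zero => simp
  | add d₁ d₂ h₁ h₂ =>
    simp only [map_add, LinearMap.add_apply, TensorProduct.add_tmul, add_mul, h₁, h₂]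
  | tmul y z =>
    induction t with
    | zero => simp
    | add t₁ t₂ h₁ h₂ => simp only [TensorProduct.add_tmul, map_add, mul_add, h₁, h₂]
    | tmul a b => simp

theorem rightPair_assoc (x : H) (t : H ⊗[k] H) (m : M) :
    Q.rightPair M x (TensorProduct.assoc k H H M (t ⊗ₜ m)) =
      TensorProduct.assoc k H H M ((t * TensorProduct.map Q.antipode Q.antipode
        (TensorProduct.comm k H H (Q.comul x))) ⊗ₜ m) := by
  rw [rightPair, conv_apply]
  generalize Q.comul x = d
  induction d with
  | zero => simp
  | add d₁ d₂ h₁ h₂ =>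
    simp only [map_add, LinearMap.add_apply, TensorProduct.add_tmul, mul_add, h₁, h₂]
  | tmul y z =>
    induction t with
    | zero => simp
    | add t₁ t₂ h₁ h₂ => simp only [TensorProduct.add_tmul, map_add, add_mul, h₁, h₂]
    | tmul a b => simp

theorem doubling_tmul (a : H) (m : M) :
    Q.doubling M (a ⊗ₜ m) = TensorProduct.assoc k H H M ((Q.comul a * Q.twistInv) ⊗ₜ m) := rfl

/-- The element `qᴸ` is `φ⁻¹` with its first two legs joined by `α`, which is what an inverse
associator followed by `absorb` computes. This form makes the intertwining properties of `doubling`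
formal. -/
theorem doubling_eq :
    Q.doubling M = Q.absorb (Q.leftPair M) ∘ₗ
      (↑(Q.assocUnit (Q.rightSlot (H ⊗[k] (H ⊗[k] M))) (tail (Q.leftPair M))
        (tail (Q.rightPair M)))⁻¹ : Module.End k (H ⊗[k] (H ⊗[k] (H ⊗[k] M)))) ∘ₗ
      (Q.twistBTmul M).lTensor H := by
  refine TensorProduct.ext' fun a m => ?_
  rw [LinearMap.comp_apply, LinearMap.comp_apply, LinearMap.lTensor_tmul, assocUnit_inv_val,
    doubling_tmul, twistInv, qL, twistBTmul_apply]
  generalize (↑Q.phi⁻¹ : H ⊗[k] (H ⊗[k] H)) = s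
  induction s with
  | zero => simp
  | add s₁ s₂ h₁ h₂ =>
    simp only [map_add, LinearMap.add_apply, TensorProduct.add_tmul, mul_add, h₁, h₂]
  | tmul x s =>
  induction s with
  | zero => simp
  | add s₁ s₂ h₁ h₂ =>
    simp only [map_add, LinearMap.add_apply, TensorProduct.add_tmul, TensorProduct.tmul_add,
      mul_add, h₁, h₂]
  | tmul y z =>
    simp [rightPair_assoc, leftPair_assoc, mul_assoc]

theorem doubling_intertwines_left :
    Intertwines (Q.doubling M) (mulLeftSlot H M) (Q.leftPair M) := by
  rw [doubling_eq]
  exact (Q.absorb_intertwines_left _).comp <| (Q.assocUnit_inv_intertwines_left _ _ _ _).comp <|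
    lTensor_intertwines_left _

/-- The defining property `Δ(S(x)) 𝕗⁻¹ = 𝕗⁻¹ (S ⊗ S)Δᶜᵒᵖ(x)` of the twist. Invariance of `𝕓`
replaces the right slot `R` by `R (L' R')`, with `L'` and `R'` the two pairs; rebracketing gives `(R
L') R'`, and `absorb` cancels `R L'`. -/
theorem doubling_intertwines_right :
    Intertwines (Q.doubling M) (Q.rightSlot M) (Q.rightPair M) := by
  rw [doubling_eq]
  have h₁ := Q.intertwines_conv (Q.absorb_intertwines_eps (Q.leftPair M))
    (Q.absorb_intertwines_tail (Q.leftPair M) (Q.rightPair M))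
  rw [eps_conv] at h₁
  have h₂ := lTensor_intertwines_tail (H := H) (Q.twistBTmul_intertwines_eps (M := M))
  rw [tail_conv, tail_eps] at h₂
  have h₃ := Q.intertwines_conv (Q.lTensor_intertwines_right (Q.twistBTmul M)) h₂
  rw [conv_eps] at h₃
  exact h₁.comp <| (Q.assocUnit_inv_intertwines _ _ _).comp h₃

theorem doubling_intertwines_tail {B : Type*} [AddCommGroup B] [Module k B]
    (f : B →ₗ[k] Module.End k M) : Intertwines (Q.doubling M) (tail f) (tail (tail f)) := by
  rw [doubling_eq]
  exact (Q.absorb_intertwines_tail _ _).comp <| (Q.assocUnit_inv_intertwines_right _ _ _ _).comp <|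
    lTensor_intertwines_tail (Q.twistBTmul_intertwines f)

/-- This is `Δ(β) 𝕗⁻¹ = 𝕓`. The pentagon for `L, R, L', R'` trades the inverse associator in
`doubling_eq` for four others. Three are trivial, by invariance of `β`, by invariance of `𝕓`, and
under `absorb`; the fourth is the triangle identity. -/
theorem doubling_beta (m : M) : Q.doubling M (Q.beta ⊗ₜ m) = Q.twistBTmul M m := by
  have h₁ := Q.map_assocUnit Q.betaTmul_intertwines_eps
    (Q.betaTmul_intertwines (Q.leftPair M)) (Q.betaTmul_intertwines (Q.rightPair M))
    (Q.twistBTmul M m)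
  have h := lTensor_intertwines_tail (H := H) (Q.twistBTmul_intertwines_eps (M := M))
  rw [tail_conv, tail_eps] at h
  have h₂ := Q.map_assocUnit (lTensor_intertwines_left (Q.twistBTmul M))
    (Q.lTensor_intertwines_right (Q.twistBTmul M)) h (Q.beta ⊗ₜ m)
  have h₃ := fun t => Q.map_assocUnit (Q.absorb_intertwines_left (Q.leftPair M))
    (Q.absorb_intertwines_eps (Q.leftPair M))
    (Q.absorb_intertwines_tail (Q.leftPair M) (Q.rightPair M)) t
  simp only [assocUnit_eps_left, assocUnit_eps_right, assocUnit_eps_mid, Units.val_one,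
    Module.End.one_apply, betaTmul_apply, LinearMap.lTensor_tmul] at h₁ h₂ h₃
  have p := Q.assocUnit_pentagon (A := Module.End k (H ⊗[k] (H ⊗[k] (H ⊗[k] M)))) (mulLeftSlot H _) (Q.rightSlot _) (tail (Q.leftPair M))
    (tail (Q.rightPair M))
  rw [mul_assoc, ← inv_mul_eq_iff_eq_mul] at p
  replace p := congrArg (fun e : (Module.End k _)ˣ =>
    (e : Module.End k (H ⊗[k] (H ⊗[k] (H ⊗[k] M)))) (Q.beta ⊗ₜ Q.twistBTmul M m)) p
  simp only [Units.val_mul, Module.End.mul_apply] at p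
  rw [← h₁, ← h₂] at p
  rw [doubling_eq, LinearMap.comp_apply, LinearMap.comp_apply, LinearMap.lTensor_tmul, p, h₃,
    absorb_assocUnit]

end Doubling

/-! ### Counitality and coherence of the doubling map -/

section DoublingCoherence

variable {M : Type*} [AddCommGroup M] [Module k M]

theorem twistBTmul_eq (m : M) : Q.twistBTmul M m =
    (↑(Q.assocUnit (Q.leftPair M) (tail (Q.rightSlot M)) (Q.rightSlot (H ⊗[k] M))) :
      Module.End k (H ⊗[k] (H ⊗[k] M)))
    ((↑(Q.assocUnit (mulLeftSlot H (H ⊗[k] M)) (tail (mulLeftSlot H M))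
      (tail (Q.rightSlot M)))⁻¹ : Module.End k (H ⊗[k] (H ⊗[k] M)))
      (Q.beta ⊗ₜ[k] (Q.beta ⊗ₜ[k] m))) := rfl

/-- `(ε ⊗ id)(Δ(a) 𝕗⁻¹) = a`. -/
theorem counitTmul_doubling (t : H ⊗[k] M) :
    Q.counitTmul (H ⊗[k] M) (Q.doubling M t) = t := by
  have hL := Q.intertwines_conv (Q.counitTmul_intertwines_left (M := H ⊗[k] M))
    (Q.counitTmul_intertwines_tail (mulLeftSlot H M))
  have hR := Q.intertwines_conv (Q.counitTmul_intertwines_tail (Q.rightSlot M))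
    (Q.counitTmul_intertwines_right (M := H ⊗[k] M))
  rw [eps_conv] at hL
  rw [conv_eps] at hR
  have key : Q.counitTmul (H ⊗[k] M) ∘ₗ Q.doubling M = LinearMap.id := by
    refine Q.eq_of_intertwines_of_beta (hL.comp Q.doubling_intertwines_left) (Intertwines.id _)
      (hR.comp Q.doubling_intertwines_right) (Intertwines.id _) fun m => ?_
    rw [LinearMap.comp_apply, doubling_beta, twistBTmul_eq,
      Q.map_assocUnit hL (Q.counitTmul_intertwines_tail _) Q.counitTmul_intertwines_right,
      Q.map_assocUnit_inv Q.counitTmul_intertwines_left (Q.counitTmul_intertwines_tail _)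
        (Q.counitTmul_intertwines_tail _)]
    simp [Q.counit_beta]
  exact congrArg (fun e => e t) key

/-- `(id ⊗ ε)(Δ(a) 𝕗⁻¹) = a`. -/
theorem lTensor_counitTmul_doubling (t : H ⊗[k] M) :
    (Q.counitTmul M).lTensor H (Q.doubling M t) = t := by
  have hL₂ := lTensor_intertwines_tail (H := H) (Q.counitTmul_intertwines_left (M := M))
  have hR₂ := lTensor_intertwines_tail (H := H) (Q.counitTmul_intertwines_right (M := M))
  rw [tail_eps] at hL₂ hR₂
  have hL₁ := lTensor_intertwines_left (H := H) (Q.counitTmul M)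
  have hR₁ := Q.lTensor_intertwines_right (Q.counitTmul M)
  have hL := Q.intertwines_conv hL₁ hL₂
  have hR := Q.intertwines_conv hR₂ hR₁
  rw [conv_eps] at hL
  rw [eps_conv] at hR
  have key : (Q.counitTmul M).lTensor H ∘ₗ Q.doubling M = LinearMap.id := by
    refine Q.eq_of_intertwines_of_beta (hL.comp Q.doubling_intertwines_left) (Intertwines.id _)
      (hR.comp Q.doubling_intertwines_right) (Intertwines.id _) fun m => ?_
    rw [LinearMap.comp_apply, doubling_beta, twistBTmul_eq, Q.map_assocUnit hL hR₂ hR₁,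
      Q.map_assocUnit_inv hL₁ hL₂ hR₂]
    simp [Q.counit_beta]
  exact congrArg (fun e => e t) key

theorem lTensor_doubling_intertwines_left : Intertwines ((Q.doubling M).lTensor H)
    (tail (mulLeftSlot H M)) (Q.conv (tail (mulLeftSlot H (H ⊗[k] M)))
      (tail (tail (mulLeftSlot H M)))) := by
  have := lTensor_intertwines_tail (H := H) (Q.doubling_intertwines_left (M := M))
  rwa [leftPair, tail_conv] at this

theorem lTensor_doubling_intertwines_right : Intertwines ((Q.doubling M).lTensor H)
    (tail (Q.rightSlot M)) (Q.conv (tail (tail (Q.rightSlot M)))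
      (tail (Q.rightSlot (H ⊗[k] M)))) := by
  have := lTensor_intertwines_tail (H := H) (Q.doubling_intertwines_right (M := M))
  rwa [rightPair, tail_conv] at this

/-- Inserting `β` in the third place makes the two neighbouring slots act trivially. -/
theorem lTensor_lTensor_betaTmul_intertwines_eps :
    Intertwines (((Q.betaTmul M).lTensor H).lTensor H) (Q.eps _)
      (Q.conv (tail (tail (mulLeftSlot H M))) (tail (tail (Q.rightSlot M)))) := by
  have h := lTensor_intertwines_tail (H := H) (lTensor_intertwines_tail (H := H)
    (Q.betaTmul_intertwines_eps (M := M)))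
  rwa [tail_conv, tail_conv, tail_eps, tail_eps] at h

/-- The six-fold coherence in the presence of a vector on which the two inner slots act
trivially. -/
theorem assocUnit_coherence_six_of_eps {N P : Type*} [AddCommGroup N] [Module k N]
    [AddCommGroup P] [Module k P] (a b c d e f : H →ₗ[k] Module.End k N) [MulMap a] [MulMap b]
    [MulMap c] [MulMap d] [MulMap e] [MulMap f] [CommMaps a b] [CommMaps a c] [CommMaps a d]
    [CommMaps a e] [CommMaps a f] [CommMaps b c] [CommMaps b d] [CommMaps b e] [CommMaps b f]
    [CommMaps c d] [CommMaps c e] [CommMaps c f] [CommMaps d e] [CommMaps d f] [CommMaps e f]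
    {a' b' e' f' : H →ₗ[k] Module.End k P} [MulMap a'] [MulMap b'] [MulMap e'] [MulMap f']
    [CommMaps a' b'] [CommMaps a' e'] [CommMaps a' f'] [CommMaps b' e'] [CommMaps b' f']
    [CommMaps e' f'] {i : P →ₗ[k] N} (ha : Intertwines i a' a) (hb : Intertwines i b' b)
    (he : Intertwines i e' e) (hf : Intertwines i f' f)
    (hcd : Intertwines i (Q.eps _) (Q.conv c d)) (p : P) :
    (Q.assocUnit a b c : Module.End k N)
      ((Q.assocUnit (Q.conv (Q.conv a b) c) d (Q.conv e f) : Module.End k N)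
      ((↑(Q.assocUnit (Q.conv a b) c d)⁻¹ : Module.End k N)
      ((Q.assocUnit (Q.conv a b) e f : Module.End k N)
      ((↑(Q.assocUnit a b e)⁻¹ : Module.End k N) (i p))))) =
    (Q.assocUnit d e f : Module.End k N)
      ((Q.assocUnit (Q.conv a (Q.conv b c)) (Q.conv d e) f : Module.End k N)
      ((↑(Q.assocUnit a (Q.conv b c) (Q.conv d e))⁻¹ : Module.End k N)
      ((Q.assocUnit (Q.conv b c) d e : Module.End k N)
      ((↑(Q.assocUnit b c d)⁻¹ : Module.End k N) (i p))))) := by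
  have six := congrArg (fun u : (Module.End k N)ˣ => (u : Module.End k N) (i p))
    (Q.assocUnit_coherence_six a b c d e f)
  have hab := Q.intertwines_conv ha hb
  have hcde := Q.intertwines_conv hcd he
  have hef := Q.intertwines_conv he hf
  simp only [Units.val_mul, Module.End.mul_apply] at six
  -- Every associator in which `c` and `d` occur multiplied together is pulled back along `i`, where
  -- that product becomes `ε`. Three of them are then `1`; the other two lose the `ε` and are pushed
  -- forward again.
  rw [← Q.map_assocUnit hb hcd he, ← Q.map_assocUnit_inv ha hb hcde, ← Q.map_assocUnit hab hcde hf,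
    ← Q.map_assocUnit hcd he hf, ← Q.map_assocUnit_inv hab hcd hef] at six
  simp only [eps_conv, assocUnit_eps_left, assocUnit_eps_mid, inv_one, Units.val_one,
    Module.End.one_apply] at six
  rw [← six, Q.map_assocUnit hab he hf, Q.map_assocUnit_inv ha hb he]

theorem lTensor_doubling_twistBTmul (m : M) :
    (Q.doubling M).lTensor H (Q.twistBTmul M m) =
      (Q.assocUnit (A := Module.End k (H ⊗[k] (H ⊗[k] (H ⊗[k] M)))) (Q.conv (mulLeftSlot H (H ⊗[k] (H ⊗[k] M)))
        (Q.conv (tail (mulLeftSlot H (H ⊗[k] M))) (tail (tail (mulLeftSlot H M)))))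
        (Q.conv (tail (tail (Q.rightSlot M))) (tail (Q.rightSlot (H ⊗[k] M))))
        (Q.rightSlot (H ⊗[k] (H ⊗[k] M))) : Module.End k (H ⊗[k] (H ⊗[k] (H ⊗[k] M))))
      ((↑(Q.assocUnit (A := Module.End k (H ⊗[k] (H ⊗[k] (H ⊗[k] M)))) (mulLeftSlot H (H ⊗[k] (H ⊗[k] M)))
        (Q.conv (tail (mulLeftSlot H (H ⊗[k] M))) (tail (tail (mulLeftSlot H M))))
        (Q.conv (tail (tail (Q.rightSlot M))) (tail (Q.rightSlot (H ⊗[k] M)))))⁻¹ :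
          Module.End k (H ⊗[k] (H ⊗[k] (H ⊗[k] M))))
      ((Q.assocUnit (A := Module.End k (H ⊗[k] (H ⊗[k] (H ⊗[k] M)))) (Q.conv (tail (mulLeftSlot H (H ⊗[k] M))) (tail (tail (mulLeftSlot H M))))
        (tail (tail (Q.rightSlot M))) (tail (Q.rightSlot (H ⊗[k] M))) :
          Module.End k (H ⊗[k] (H ⊗[k] (H ⊗[k] M))))
      ((↑(Q.assocUnit (A := Module.End k (H ⊗[k] (H ⊗[k] (H ⊗[k] M)))) (tail (mulLeftSlot H (H ⊗[k] M))) (tail (tail (mulLeftSlot H M)))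
        (tail (tail (Q.rightSlot M))))⁻¹ : Module.End k (H ⊗[k] (H ⊗[k] (H ⊗[k] M))))
      (Q.beta ⊗ₜ[k] (Q.beta ⊗ₜ[k] (Q.beta ⊗ₜ[k] m)))))) := by
  have hL₁ := lTensor_intertwines_left (H := H) (Q.doubling M)
  have hR₁ := Q.lTensor_intertwines_right (Q.doubling M)
  have hL₂ := Q.lTensor_doubling_intertwines_left (M := M)
  have hR₂ := Q.lTensor_doubling_intertwines_right (M := M)
  have hb := fun f : H →ₗ[k] Module.End k (H ⊗[k] (H ⊗[k] M)) => Q.betaTmul_intertwines f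
  rw [twistBTmul_eq, Q.map_assocUnit (Q.intertwines_conv hL₁ hL₂) hR₂ hR₁,
    Q.map_assocUnit_inv hL₁ hL₂ hR₂, LinearMap.lTensor_tmul, doubling_beta, twistBTmul_eq,
    ← betaTmul_apply, Q.map_assocUnit (Q.intertwines_conv (hb _) (hb _)) (hb _) (hb _),
    Q.map_assocUnit_inv (hb _) (hb _) (hb _), betaTmul_apply]

theorem doubling_twistBTmul (m : M) :
    Q.doubling (H ⊗[k] M) (Q.twistBTmul M m) =
      (Q.assocUnit (A := Module.End k (H ⊗[k] (H ⊗[k] (H ⊗[k] M)))) (Q.conv (Q.leftPair (H ⊗[k] M)) (tail (tail (mulLeftSlot H M))))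
        (tail (tail (Q.rightSlot M))) (Q.rightPair (H ⊗[k] M)) :
          Module.End k (H ⊗[k] (H ⊗[k] (H ⊗[k] M))))
      ((↑(Q.assocUnit (A := Module.End k (H ⊗[k] (H ⊗[k] (H ⊗[k] M)))) (Q.leftPair (H ⊗[k] M)) (tail (tail (mulLeftSlot H M)))
        (tail (tail (Q.rightSlot M))))⁻¹ : Module.End k (H ⊗[k] (H ⊗[k] (H ⊗[k] M))))
      (Q.twistBTmul (H ⊗[k] M) (Q.beta ⊗ₜ[k] m))) := by
  have hl₁ := Q.doubling_intertwines_left (M := H ⊗[k] M)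
  have hr₁ := Q.doubling_intertwines_right (M := H ⊗[k] M)
  have hl₂ := Q.doubling_intertwines_tail (mulLeftSlot H M)
  have hr₂ := Q.doubling_intertwines_tail (Q.rightSlot M)
  rw [twistBTmul_eq, Q.map_assocUnit (Q.intertwines_conv hl₁ hl₂) hr₂ hr₁,
    Q.map_assocUnit_inv hl₁ hl₂ hr₂, doubling_beta]

theorem lTensor_doubling_comp_intertwines_left :
    Intertwines ((Q.doubling M).lTensor H ∘ₗ Q.doubling M) (mulLeftSlot H M)
      (Q.conv (mulLeftSlot H (H ⊗[k] (H ⊗[k] M)))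
        (Q.conv (tail (mulLeftSlot H (H ⊗[k] M))) (tail (tail (mulLeftSlot H M))))) :=
  (Q.intertwines_conv (lTensor_intertwines_left (Q.doubling M))
    Q.lTensor_doubling_intertwines_left).comp Q.doubling_intertwines_left

theorem lTensor_doubling_comp_intertwines_right :
    Intertwines ((Q.doubling M).lTensor H ∘ₗ Q.doubling M) (Q.rightSlot M)
      (Q.conv (Q.conv (tail (tail (Q.rightSlot M))) (tail (Q.rightSlot (H ⊗[k] M))))
        (Q.rightSlot (H ⊗[k] (H ⊗[k] M)))) :=
  (Q.intertwines_conv Q.lTensor_doubling_intertwines_right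
    (Q.lTensor_intertwines_right (Q.doubling M))).comp Q.doubling_intertwines_right

theorem doubling_comp_intertwines_left :
    Intertwines (Q.doubling (H ⊗[k] M) ∘ₗ Q.doubling M) (mulLeftSlot H M)
      (Q.conv (Q.conv (mulLeftSlot H (H ⊗[k] (H ⊗[k] M))) (tail (mulLeftSlot H (H ⊗[k] M))))
        (tail (tail (mulLeftSlot H M)))) :=
  (Q.intertwines_conv Q.doubling_intertwines_left
    (Q.doubling_intertwines_tail (mulLeftSlot H M))).comp Q.doubling_intertwines_left

theorem doubling_comp_intertwines_right :
    Intertwines (Q.doubling (H ⊗[k] M) ∘ₗ Q.doubling M) (Q.rightSlot M)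
      (Q.conv (tail (tail (Q.rightSlot M)))
        (Q.conv (tail (Q.rightSlot (H ⊗[k] M))) (Q.rightSlot (H ⊗[k] (H ⊗[k] M))))) :=
  (Q.intertwines_conv (Q.doubling_intertwines_tail (Q.rightSlot M))
    Q.doubling_intertwines_right).comp Q.doubling_intertwines_right

/-- The operator form of the coherence of Drinfeld's twist,
`φ (Δ ⊗ id)(𝕗⁻¹) (𝕗⁻¹ ⊗ 1) = (id ⊗ Δ)(𝕗⁻¹) (1 ⊗ 𝕗⁻¹) (S ⊗ S ⊗ S)(φ₃ ⊗ φ₂ ⊗ φ₁)`. -/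
theorem doubling_coherence (t : H ⊗[k] M) :
    (Q.assocUnit (tail (tail (Q.rightSlot M))) (tail (Q.rightSlot (H ⊗[k] M)))
        (Q.rightSlot (H ⊗[k] (H ⊗[k] M))) : Module.End k (H ⊗[k] (H ⊗[k] (H ⊗[k] M))))
      ((Q.doubling M).lTensor H (Q.doubling M t)) =
    (Q.assocUnit (mulLeftSlot H (H ⊗[k] (H ⊗[k] M))) (tail (mulLeftSlot H (H ⊗[k] M)))
        (tail (tail (mulLeftSlot H M))) : Module.End k (H ⊗[k] (H ⊗[k] (H ⊗[k] M))))
      (Q.doubling (H ⊗[k] M) (Q.doubling M t)) := by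
  have hXL := Q.assocUnit_intertwines_left (tail (tail (Q.rightSlot M)))
    (tail (Q.rightSlot (H ⊗[k] M))) (Q.rightSlot (H ⊗[k] (H ⊗[k] M)))
    (Q.conv (mulLeftSlot H (H ⊗[k] (H ⊗[k] M)))
      (Q.conv (tail (mulLeftSlot H (H ⊗[k] M))) (tail (tail (mulLeftSlot H M)))))
  have hYL := Q.assocUnit_intertwines (mulLeftSlot H (H ⊗[k] (H ⊗[k] M)))
    (tail (mulLeftSlot H (H ⊗[k] M))) (tail (tail (mulLeftSlot H M)))
  have hXR := Q.assocUnit_intertwines (tail (tail (Q.rightSlot M)))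
    (tail (Q.rightSlot (H ⊗[k] M))) (Q.rightSlot (H ⊗[k] (H ⊗[k] M)))
  have hYR := Q.assocUnit_intertwines_right (mulLeftSlot H (H ⊗[k] (H ⊗[k] M)))
    (tail (mulLeftSlot H (H ⊗[k] M))) (tail (tail (mulLeftSlot H M)))
    (Q.conv (tail (tail (Q.rightSlot M))) (Q.conv (tail (Q.rightSlot (H ⊗[k] M)))
      (Q.rightSlot (H ⊗[k] (H ⊗[k] M)))))
  replace hXL := hXL.comp (Q.lTensor_doubling_comp_intertwines_left (M := M))
  replace hYL := hYL.comp (Q.doubling_comp_intertwines_left (M := M))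
  replace hXR := hXR.comp (Q.lTensor_doubling_comp_intertwines_right (M := M))
  replace hYR := hYR.comp (Q.doubling_comp_intertwines_right (M := M))
  -- Both sides carry the left slot to `L₁ (L₂ L₃)` and the right slot to `R₃ (R₂ R₁)`, so comparing
  -- them at `β` is enough. There each is a chain of associators on `β ⊗ β ⊗ β ⊗ m`, and the
  -- innermost `β` makes `L₃ R₃` trivial.
  refine congrArg (fun e => e t) (Q.eq_of_intertwines_of_beta hXL hYL hXR hYR fun m => ?_)
  have h₁ := lTensor_intertwines_left (H := H) ((Q.betaTmul M).lTensor H)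
  have h₂ := lTensor_intertwines_tail (H := H) (lTensor_intertwines_left (H := H) (Q.betaTmul M))
  have h₅ := lTensor_intertwines_tail (H := H) (Q.lTensor_intertwines_right (Q.betaTmul M))
  have h₆ := Q.lTensor_intertwines_right ((Q.betaTmul M).lTensor H)
  have six := Q.assocUnit_coherence_six_of_eps (mulLeftSlot H (H ⊗[k] (H ⊗[k] M)))
    (tail (mulLeftSlot H (H ⊗[k] M))) (tail (tail (mulLeftSlot H M)))
    (tail (tail (Q.rightSlot M))) (tail (Q.rightSlot (H ⊗[k] M)))
    (Q.rightSlot (H ⊗[k] (H ⊗[k] M))) h₁ h₂ h₅ h₆ (Q.lTensor_lTensor_betaTmul_intertwines_eps (M := M))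
    (Q.beta ⊗ₜ[k] (Q.beta ⊗ₜ[k] m))
  simp only [LinearMap.lTensor_tmul, betaTmul_apply] at six
  rw [LinearMap.comp_apply, LinearMap.comp_apply, LinearMap.comp_apply, LinearMap.comp_apply,
    doubling_beta, lTensor_doubling_twistBTmul, doubling_twistBTmul, twistBTmul_eq]
  exact six.symm

end DoublingCoherence

/-! ### The rebracketing part of `ω` -/

section OmegaUnit

variable {M N : Type*} [AddCommGroup M] [Module k M] [AddCommGroup N] [Module k N]
  (a b c d e : H →ₗ[k] Module.End k M) [MulMap a] [MulMap b] [MulMap c] [MulMap d]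
  [MulMap e] [CommMaps a b] [CommMaps a c] [CommMaps a d] [CommMaps a e] [CommMaps b c]
  [CommMaps b d] [CommMaps b e] [CommMaps c d] [CommMaps c e] [CommMaps d e]

theorem omegaUnit_apply (m : M) : (Q.omegaUnit a b c d e : Module.End k M) m =
    (Q.assocUnit a (Q.conv b c) d : Module.End k M)
      ((↑(Q.assocUnit (Q.conv a (Q.conv b c)) d e)⁻¹ : Module.End k M)
        ((Q.assocUnit a b c : Module.End k M) m)) := rfl

theorem omegaUnit_intertwines :
    Intertwines (Q.omegaUnit a b c d e : Module.End k M)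
      (Q.conv (Q.conv (Q.conv a b) c) (Q.conv d e))
      (Q.conv (Q.conv a (Q.conv (Q.conv b c) d)) e) := by
  have h₁ := Q.intertwines_conv (Q.assocUnit_intertwines a b c)
    (Q.assocUnit_intertwines_right a b c (Q.conv d e))
  have h₂ := Q.assocUnit_inv_intertwines (Q.conv a (Q.conv b c)) d e
  have h₃ := Q.intertwines_conv (Q.assocUnit_intertwines a (Q.conv b c) d)
    (Q.assocUnit_intertwines_right a (Q.conv b c) d e)
  exact h₃.comp (h₂.comp h₁)

variable {a b c d e} {a' b' c' d' e' : H →ₗ[k] Module.End k N} [MulMap a'] [MulMap b']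
  [MulMap c'] [MulMap d'] [MulMap e'] [CommMaps a' b'] [CommMaps a' c'] [CommMaps a' d']
  [CommMaps a' e'] [CommMaps b' c'] [CommMaps b' d'] [CommMaps b' e'] [CommMaps c' d']
  [CommMaps c' e'] [CommMaps d' e'] {i : M →ₗ[k] N}

theorem map_omegaUnit (ha : Intertwines i a a') (hb : Intertwines i b b')
    (hc : Intertwines i c c') (hd : Intertwines i d d') (he : Intertwines i e e') (m : M) :
    i ((Q.omegaUnit a b c d e : Module.End k M) m) =
      (Q.omegaUnit a' b' c' d' e' : Module.End k N) (i m) := by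
  have hbc := Q.intertwines_conv hb hc
  rw [omegaUnit_apply, omegaUnit_apply, Q.map_assocUnit ha hbc hd,
    Q.map_assocUnit_inv (Q.intertwines_conv ha hbc) hd he, Q.map_assocUnit ha hb hc]

end OmegaUnit

/-! ### The free coaction as an operator -/

section FreeCoaction

variable {M N : Type*} [AddCommGroup M] [Module k M] [AddCommGroup N] [Module k N]

/-- The action `h ▷ (a ⊗ m) = h_{(1,1)} a S(h₂) ⊗ h_{(1,2)} m` attached to an action `f` on `M`. -/
abbrev adMap (f : H →ₗ[k] Module.End k M) : H →ₗ[k] Module.End k (H ⊗[k] M) :=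
  Q.conv (Q.conv (mulLeftSlot H M) (tail f)) (Q.rightSlot M)

/-- The action of `ω` on `H ⊗ H ⊗ M`, without the factor given by Drinfeld's twist. -/
abbrev omegaSlots (f : H →ₗ[k] Module.End k M) [MulMap f] :
    (Module.End k (H ⊗[k] (H ⊗[k] M)))ˣ :=
  Q.omegaUnit (mulLeftSlot H (H ⊗[k] M)) (tail (mulLeftSlot H M)) (tail (tail f))
    (tail (Q.rightSlot M)) (Q.rightSlot (H ⊗[k] M))

/-- The map `a ⊗ m ↦ ω₁ a₁ ω₅ ⊗ ω₂ a₂ ω₄ ⊗ ω₃ m` attached to an action `f` on `M`. -/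
def freeCoact (f : H →ₗ[k] Module.End k M) [MulMap f] :
    H ⊗[k] M →ₗ[k] H ⊗[k] (H ⊗[k] M) :=
  (Q.omegaSlots f : Module.End k (H ⊗[k] (H ⊗[k] M))) ∘ₗ Q.doubling M

variable (f : H →ₗ[k] Module.End k M) [MulMap f]

theorem freeCoact_apply (t : H ⊗[k] M) : Q.freeCoact f t =
    (Q.omegaSlots f : Module.End k (H ⊗[k] (H ⊗[k] M))) (Q.doubling M t) := rfl

theorem freeCoact_intertwines :
    Intertwines (Q.freeCoact f) (Q.adMap f) (Q.adMap (Q.adMap f)) := by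
  have h₁ := Q.intertwines_conv (Q.intertwines_conv (Q.doubling_intertwines_left (M := M))
    (Q.doubling_intertwines_tail f)) (Q.doubling_intertwines_right (M := M))
  have h₂ := Q.omegaUnit_intertwines (mulLeftSlot H (H ⊗[k] M)) (tail (mulLeftSlot H M))
    (tail (tail f)) (tail (Q.rightSlot M)) (Q.rightSlot (H ⊗[k] M))
  have h₃ := h₂.comp h₁
  rw [← tail_conv, ← tail_conv] at h₃
  exact h₃

theorem counitTmul_freeCoact (t : H ⊗[k] M) :
    Q.counitTmul (H ⊗[k] M) (Q.freeCoact f t) = t := by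
  rw [freeCoact_apply, Q.map_omegaUnit Q.counitTmul_intertwines_left
    (Q.counitTmul_intertwines_tail (mulLeftSlot H M)) (Q.counitTmul_intertwines_tail (tail f))
    (Q.counitTmul_intertwines_tail (Q.rightSlot M)) Q.counitTmul_intertwines_right,
    counitTmul_doubling, omegaUnit_apply]
  simp

theorem lTensor_counitTmul_freeCoact (t : H ⊗[k] M) :
    (Q.counitTmul M).lTensor H (Q.freeCoact f t) = t := by
  have hL₂ := lTensor_intertwines_tail (H := H) (Q.counitTmul_intertwines_left (M := M))
  have hR₂ := lTensor_intertwines_tail (H := H) (Q.counitTmul_intertwines_right (M := M))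
  rw [tail_eps] at hL₂ hR₂
  have hf := lTensor_intertwines_tail (H := H) (Q.counitTmul_intertwines_tail f)
  rw [freeCoact_apply, Q.map_omegaUnit (lTensor_intertwines_left (H := H) (Q.counitTmul M)) hL₂ hf
    hR₂ (Q.lTensor_intertwines_right (Q.counitTmul M)), lTensor_counitTmul_doubling,
    omegaUnit_apply]
  simp

theorem doubling_natural (e : M →ₗ[k] N) (t : H ⊗[k] M) :
    (e.lTensor H).lTensor H (Q.doubling M t) = Q.doubling N (e.lTensor H t) := by
  induction t with
  | zero => simp
  | add t₁ t₂ h₁ h₂ => simp only [map_add, h₁, h₂]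
  | tmul a m =>
    rw [LinearMap.lTensor_tmul, doubling_tmul, doubling_tmul]
    generalize Q.comul a * Q.twistInv = d
    induction d with
    | zero => simp
    | add d₁ d₂ h₁ h₂ => simp only [map_add, TensorProduct.add_tmul, h₁, h₂]
    | tmul x y => simp

variable {f} in
theorem freeCoact_natural {f' : H →ₗ[k] Module.End k N} [MulMap f'] {e : M →ₗ[k] N}
    (h : Intertwines e f f') (t : H ⊗[k] M) :
    (e.lTensor H).lTensor H (Q.freeCoact f t) = Q.freeCoact f' (e.lTensor H t) := by
  rw [freeCoact_apply, freeCoact_apply, ← doubling_natural]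
  exact Q.map_omegaUnit (lTensor_intertwines_left (H := H) (e.lTensor H))
    (lTensor_intertwines_tail (lTensor_intertwines_left (H := H) e))
    (lTensor_intertwines_tail (lTensor_intertwines_tail h))
    (lTensor_intertwines_tail (Q.lTensor_intertwines_right e))
    (Q.lTensor_intertwines_right (e.lTensor H)) _

theorem lTensor_omegaUnit (a b c d e : H →ₗ[k] Module.End k M) [MulMap a] [MulMap b] [MulMap c]
    [MulMap d] [MulMap e] [CommMaps a b] [CommMaps a c] [CommMaps a d] [CommMaps a e]
    [CommMaps b c] [CommMaps b d] [CommMaps b e] [CommMaps c d] [CommMaps c e] [CommMaps d e]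
    (t : H ⊗[k] M) :
    (Q.omegaUnit a b c d e : Module.End k M).lTensor H t =
      (Q.omegaUnit (M := H ⊗[k] M) (tail a) (tail b) (tail c) (tail d) (tail e) : Module.End k (H ⊗[k] M)) t := by
  induction t with
  | zero => simp
  | add t₁ t₂ h₁ h₂ => simp only [map_add, h₁, h₂]
  | tmul x m =>
    have h : ∀ g : H →ₗ[k] Module.End k M, Intertwines (TensorProduct.mk k H M x) g (tail g) :=
      fun _ _ _ => rfl
    exact Q.map_omegaUnit (h a) (h b) (h c) (h d) (h e) m

/-- Naturality moves the second doubling past the first rebracketing. With `freeCoact_freeCoact`,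
both sides of coassociativity become two rebracketings applied to an iterated doubling. -/
theorem lTensor_freeCoact_freeCoact (t : H ⊗[k] M) :
    (Q.freeCoact f).lTensor H (Q.freeCoact f t) =
      (Q.omegaUnit (M := H ⊗[k] (H ⊗[k] (H ⊗[k] M))) (tail (mulLeftSlot H (H ⊗[k] M)))
        (tail (tail (mulLeftSlot H M))) (tail (tail (tail f))) (tail (tail (Q.rightSlot M)))
        (tail (Q.rightSlot (H ⊗[k] M))) :
        Module.End k (H ⊗[k] (H ⊗[k] (H ⊗[k] M))))
      ((Q.omegaUnit (mulLeftSlot H (H ⊗[k] (H ⊗[k] M)))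
        (Q.conv (tail (mulLeftSlot H (H ⊗[k] M))) (tail (tail (mulLeftSlot H M))))
        (tail (tail (tail f)))
        (Q.conv (tail (tail (Q.rightSlot M))) (tail (Q.rightSlot (H ⊗[k] M))))
        (Q.rightSlot (H ⊗[k] (H ⊗[k] M))) : Module.End k (H ⊗[k] (H ⊗[k] (H ⊗[k] M))))
      ((Q.doubling M).lTensor H (Q.doubling M t))) := by
  have hf := lTensor_intertwines_tail (H := H) (Q.doubling_intertwines_tail f)
  have h₁ := Q.map_omegaUnit (lTensor_intertwines_left (H := H) (Q.doubling M))
    (Q.lTensor_doubling_intertwines_left (M := M)) hf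
    (Q.lTensor_doubling_intertwines_right (M := M)) (Q.lTensor_intertwines_right (Q.doubling M))
    (Q.doubling M t)
  rw [← h₁, ← lTensor_omegaUnit, freeCoact, LinearMap.lTensor_comp]
  rfl

theorem freeCoact_freeCoact (t : H ⊗[k] M) :
    Q.freeCoact (Q.adMap f) (Q.freeCoact f t) =
      (Q.omegaUnit (mulLeftSlot H (H ⊗[k] (H ⊗[k] M))) (tail (mulLeftSlot H (H ⊗[k] M)))
        (Q.conv (Q.conv (tail (tail (mulLeftSlot H M))) (tail (tail (tail f))))
          (tail (tail (Q.rightSlot M))))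
        (tail (Q.rightSlot (H ⊗[k] M))) (Q.rightSlot (H ⊗[k] (H ⊗[k] M))) :
        Module.End k (H ⊗[k] (H ⊗[k] (H ⊗[k] M))))
      ((Q.omegaUnit
        (Q.conv (mulLeftSlot H (H ⊗[k] (H ⊗[k] M))) (tail (mulLeftSlot H (H ⊗[k] M))))
        (tail (tail (mulLeftSlot H M))) (tail (tail (tail f))) (tail (tail (Q.rightSlot M)))
        (Q.conv (tail (Q.rightSlot (H ⊗[k] M))) (Q.rightSlot (H ⊗[k] (H ⊗[k] M)))) :
        Module.End k (H ⊗[k] (H ⊗[k] (H ⊗[k] M))))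
      (Q.doubling (H ⊗[k] M) (Q.doubling M t))) := by
  have h₁ := Q.map_omegaUnit (Q.doubling_intertwines_left (M := H ⊗[k] M))
    (Q.doubling_intertwines_tail (mulLeftSlot H M)) (Q.doubling_intertwines_tail (tail f))
    (Q.doubling_intertwines_tail (Q.rightSlot M))
    (Q.doubling_intertwines_right (M := H ⊗[k] M)) (Q.doubling M t)
  rw [← h₁, freeCoact_apply, freeCoact_apply]
  simp only [omegaSlots, adMap, tail_conv]

/-- The free coaction is coassociative. -/
theorem freeCoact_coassoc (t : H ⊗[k] M) :
    (Q.freeCoact f).lTensor H (Q.freeCoact f t) =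
      Q.freeCoact (Q.adMap f) (Q.freeCoact f t) := by
  have h := Q.omegaUnit_coherence (mulLeftSlot H (H ⊗[k] (H ⊗[k] M)))
    (tail (mulLeftSlot H (H ⊗[k] M))) (tail (tail (mulLeftSlot H M))) (tail (tail (tail f)))
    (tail (tail (Q.rightSlot M))) (tail (Q.rightSlot (H ⊗[k] M)))
    (Q.rightSlot (H ⊗[k] (H ⊗[k] M)))
  replace h := congrArg (fun e : (Module.End k _)ˣ =>
    (e : Module.End k (H ⊗[k] (H ⊗[k] (H ⊗[k] M)))) (Q.doubling (H ⊗[k] M) (Q.doubling M t))) h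
  simp only [Units.val_mul, Module.End.mul_apply] at h
  -- The rebracketings differ by an associator of the left slots and an inverse associator of the
  -- right slots, and coherence of the twist makes these cancel.
  rw [lTensor_freeCoact_freeCoact, freeCoact_freeCoact, ← h, ← doubling_coherence]
  congr 2
  rw [← Module.End.mul_apply, Units.inv_mul, Module.End.one_apply]

end FreeCoaction

/-! ### From operators back to `ω` and the modules `R(V)` -/

section ModuleCat

variable (V : ModuleCat.{v} H)

instance : MulMap (actionMap (k := k) V) where
  one := map_one (Algebra.lsmul k k V)
  mul := map_mul (Algebra.lsmul k k V)

@[simp]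
theorem actionMap_apply (x : H) (m : V) : actionMap (k := k) V x m = x • m := rfl

theorem adAction_eq (h : H) : Q.adAction V h = Q.adMap (actionMap V) h :=
  Q.contract_splitFirst (mulLeftSlot H V) (tail (actionMap V)) (Q.rightSlot V) (Q.comul h)

/-- The last two legs act by right multiplication, which reverses products. Hence the twist,
although the leftmost factor of `ω`, acts first and can be joined to `Δ(a)`. -/
theorem fiveAct_mul (s : H ⊗[k] (H ⊗[k] (H ⊗[k] H))) (p : H ⊗[k] (H ⊗[k] H)) (c t : H ⊗[k] H)
    (m : V) :
    fiveAct V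
      (((1 : H) ⊗ₜ[k] ((1 : H) ⊗ₜ[k] ((1 : H) ⊗ₜ[k] TensorProduct.comm k H H c))) *
        TensorProduct.map (LinearMap.id : H →ₗ[k] H)
          ((TensorProduct.assoc k H H (H ⊗[k] H)).toLinearMap ∘ₗ
            TensorProduct.map Q.comul.toLinearMap (TensorProduct.map Q.antipode Q.antipode)) s *
        onTail k (onTail k (padOne k (H ⊗[k] H))) p) (TensorProduct.assoc k H H V (t ⊗ₜ[k] m)) =
    contract k (mulLeftSlot H (H ⊗[k] V)) (contract k
      (Q.conv (tail (mulLeftSlot H V)) (tail (tail (actionMap V))))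
      (contract k (tail (Q.rightSlot V)) (Q.rightSlot (H ⊗[k] V)))) s
      (tri (mulLeftSlot H (H ⊗[k] V)) (tail (mulLeftSlot H V)) (tail (tail (actionMap V))) p
        (TensorProduct.assoc k H H V ((t * c) ⊗ₜ[k] m))) := by
  induction c with
  | zero => simp
  | add c₁ c₂ h₁ h₂ =>
    simp only [map_add, TensorProduct.tmul_add, add_mul, LinearMap.add_apply, h₁, h₂, mul_add,
      TensorProduct.add_tmul]
  | tmul c₁ c₂ =>
  induction t with
  | zero => simp
  | add t₁ t₂ h₁ h₂ => simp only [map_add, TensorProduct.add_tmul, add_mul, h₁, h₂]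
  | tmul a b =>
  induction p with
  | zero => simp
  | add p₁ p₂ h₁ h₂ => simp only [map_add, mul_add, LinearMap.add_apply, h₁, h₂]
  | tmul p₁ p =>
  induction p with
  | zero => simp
  | add p₁ p₂ h₁ h₂ =>
    simp only [map_add, TensorProduct.tmul_add, mul_add, LinearMap.add_apply, h₁, h₂]
  | tmul p₂ p₃ =>
  induction s with
  | zero => simp
  | add s₁ s₂ h₁ h₂ => simp only [map_add, mul_add, add_mul, LinearMap.add_apply, h₁, h₂]
  | tmul x s =>
  induction s with
  | zero => simp
  | add s₁ s₂ h₁ h₂ =>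
    simp only [map_add, TensorProduct.tmul_add, mul_add, add_mul, LinearMap.add_apply, h₁, h₂]
  | tmul y s =>
  induction s with
  | zero => simp
  | add s₁ s₂ h₁ h₂ =>
    simp only [map_add, TensorProduct.tmul_add, mul_add, add_mul, LinearMap.add_apply, h₁, h₂]
  | tmul z z' =>
  rw [TensorProduct.map_tmul, LinearMap.comp_apply, TensorProduct.map_tmul, contract_tmul,
    contract_tmul, conv_apply]
  change fiveAct V (_ * x ⊗ₜ[k] (TensorProduct.assoc k H H (H ⊗[k] H) (Q.comul y ⊗ₜ[k] _)) * _) _ =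
    _
  generalize Q.comul y = d
  induction d with
  | zero => simp
  | add d₁ d₂ h₁ h₂ =>
    simp only [map_add, TensorProduct.tmul_add, TensorProduct.add_tmul, mul_add, add_mul,
      LinearMap.add_apply, h₁, h₂]
  | tmul y₁ y₂ => simp [onTail, padOne, fiveAct_tmul, mul_assoc, mul_smul]

theorem omegaMap_eq : Q.omegaMap V = Q.freeCoact (actionMap V) := by
  refine TensorProduct.ext' fun a m => ?_
  change fiveAct V Q.omega (TensorProduct.assoc k H H V (Q.comul a ⊗ₜ[k] m)) = _
  rw [omega, fiveAct_mul, chi, MulMap.mul, contract_splitFirst, contract_padOne,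
    freeCoact_apply, doubling_tmul, omegaUnit_apply]
  rfl

theorem toRad_intertwines :
    Intertwines (Q.toRad V).toLinearMap (Q.adMap (actionMap V)) (actionMap (Q.radObj V)) :=
  fun h t => by
    rw [← adAction_eq]
    rfl

theorem radCoact_toRad_eq (t : H ⊗[k] V) : Q.radCoact V (Q.toRad V t) =
    (Q.toRad V).toLinearMap.lTensor H (Q.freeCoact (actionMap V) t) := by
  rw [← omegaMap_eq]
  rfl

/-- The free coaction makes `R(V)` a Yetter-Drinfeld module of the second kind. -/
theorem isYetterDrinfeld_radObj : Q.IsYetterDrinfeld (Q.radObj V) (Q.radCoact V) where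
  coassoc m := by
    obtain ⟨t, rfl⟩ := (Q.toRad V).surjective m
    -- Since `toRad` intertwines the two descriptions of the action on `R(V)`, naturality transports
    -- the claim to `H ⊗ V`, where it is `freeCoact_coassoc`.
    rw [omegaMap_eq, radCoact_toRad_eq, ← Q.freeCoact_natural (Q.toRad_intertwines V),
      ← freeCoact_coassoc]
    change (Q.radCoact V).lTensor H _ = _
    have h : Q.radCoact V ∘ₗ (Q.toRad V).toLinearMap =
        (Q.toRad V).toLinearMap.lTensor H ∘ₗ Q.freeCoact (actionMap V) :=
      LinearMap.ext (Q.radCoact_toRad_eq V)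
    rw [← LinearMap.lTensor_comp_apply, h, LinearMap.lTensor_comp_apply]
  counit m := by
    obtain ⟨t, rfl⟩ := (Q.toRad V).surjective m
    rw [radCoact_toRad_eq]
    conv_rhs => rw [← Q.counitTmul_freeCoact (actionMap V) t]
    generalize Q.freeCoact (actionMap V) t = s
    induction s with
    | zero => simp
    | add s₁ s₂ h₁ h₂ => simp only [map_add, h₁, h₂]
    | tmul a x => simp
  compat h m := by
    obtain ⟨t, rfl⟩ := (Q.toRad V).surjective m
    rw [smul_toRad, radCoact_toRad_eq, radCoact_toRad_eq, adAction_eq, adAction_eq,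
      Q.freeCoact_intertwines (actionMap V) h t]
    exact Q.intertwines_conv (Q.intertwines_conv (lTensor_intertwines_left _)
      (lTensor_intertwines_tail (Q.toRad_intertwines V))) (Q.lTensor_intertwines_right _) h _

end ModuleCat

/-! ### Unit, counit and triangle identities -/

section Adjunction

/-- The counit `a ⊗ v ↦ ε(a) v` of the adjunction. -/
def radCounit (V : ModuleCat.{max u v} H) : Q.radObj V ⟶ V :=
  ModuleCat.ofHom
    { toFun := fun t : Q.RadCarrier V => (Q.counitTmul V : H ⊗[k] V →ₗ[k] V) t
      map_add' := fun s t => map_add (Q.counitTmul V) s t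
      map_smul' := fun h t => by
        have := Q.intertwines_conv (Q.intertwines_conv (Q.counitTmul_intertwines_left (M := V))
          (Q.counitTmul_intertwines_tail (actionMap V))) (Q.counitTmul_intertwines_right (M := V))
        -- Under `ε` both outer slots become the unit object, so the action on `R(V)` collapses to
        -- the action on `V`.
        rw [eps_conv, conv_eps] at this
        change Q.counitTmul V (Q.adAction V h t) = _
        rw [adAction_eq]
        exact this h t }

theorem radCounit_toRad (V : ModuleCat.{max u v} H) (t : H ⊗[k] V) : radCounit.{w, u, v} Q V (Q.toRad V t) = Q.counitTmul V t := rfl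

theorem radCounit_naturality {V W : ModuleCat.{max u v} H} (f : V ⟶ W) :
    Q.radMap f ≫ radCounit.{w, u, v} Q W = radCounit.{w, u, v} Q V ≫ f := by
  ext t
  obtain ⟨t, rfl⟩ := (Q.toRad V).surjective t
  rw [ModuleCat.comp_apply, ModuleCat.comp_apply, radMap_toRad, radCounit_toRad, radCounit_toRad]
  induction t with
  | zero => simp
  | add t₁ t₂ h₁ h₂ => simp only [map_add, h₁, h₂]
  | tmul a m =>
    rw [idTensor_tmul, counitTmul_tmul, counitTmul_tmul]
    exact (map_smul (f.hom.restrictScalars k) _ _).symm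

/-- The unit `m ↦ m₋₁ ⊗ m₀` of the adjunction. -/
def radUnit (M : YetterDrinfeld.{w, u, max u v} Q) : M.obj ⟶ Q.radObj M.obj :=
  ModuleCat.ofHom
    { toFun := fun m => Q.toRad M.obj (M.coact m)
      map_add' := fun s t => by
        rw [map_add, map_add]
        rfl
      map_smul' := fun h m => by
        rw [M.isYetterDrinfeld.compat, ← smul_toRad]
        rfl }

theorem radUnit_apply (M : YetterDrinfeld.{w, u, max u v} Q) (m : M.obj) :
    radUnit.{w, u, v} Q M m = Q.toRad M.obj (M.coact m) := rfl

/-- The coassociativity axiom of `M` is precisely colinearity of its coaction as a map into the free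
coaction. -/
theorem radCoact_radUnit (M : YetterDrinfeld.{w, u, max u v} Q) (m : M.obj) :
    Q.radCoact M.obj (radUnit.{w, u, v} Q M m) =
      TensorProduct.map LinearMap.id ((radUnit.{w, u, v} Q M).hom.restrictScalars k) (M.coact m) := by
  rw [radUnit_apply, radCoact_toRad, ← M.isYetterDrinfeld.coassoc, ← LinearMap.comp_apply,
    ← TensorProduct.map_comp, LinearMap.id_comp]
  rfl

/-- The adjunction between the forgetful functor and `R`. -/
def forgetRadAdjunction :
    Q.forget ⊣ Q.radFunctor (fun V : ModuleCat.{max u v} H => Q.isYetterDrinfeld_radObj V) :=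
  Adjunction.mkOfUnitCounit
    { unit :=
        { app := fun M => ⟨radUnit.{w, u, v} Q M, radCoact_radUnit.{w, u, v} Q M⟩
          naturality := fun M N f => by
            apply YetterDrinfeld.Hom.ext
            ext m
            exact congrArg (Q.toRad N.obj) (f.comm m) }
      counit :=
        { app := fun V => radCounit.{w, u, v} Q V
          naturality := fun V W f => radCounit_naturality.{w, u, v} Q f }
      left_triangle := by
        ext M m
        exact M.isYetterDrinfeld.counit m
      right_triangle := by
        ext V
        apply YetterDrinfeld.Hom.ext
        ext t
        obtain ⟨t, rfl⟩ := (Q.toRad V).surjective t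
        change Q.radMap (radCounit.{w, u, v} Q V) (Q.toRad (Q.radObj V) (Q.radCoact V (Q.toRad V t))) =
          Q.toRad V t
        rw [radMap_toRad, radCoact_toRad_eq]
        congr 1
        -- After unfolding, the triangle identity is `(id ⊗ ε) δ = id` for the free coaction.
        conv_rhs => rw [← Q.lTensor_counitTmul_freeCoact (actionMap V) t]
        generalize Q.freeCoact (actionMap V) t = s
        induction s with
        | zero => simp
        | add s₁ s₂ h₁ h₂ => simp only [map_add, h₁, h₂]
        | tmul a x => rfl }

end Adjunction

end QuasiHopfAlgebra

end

theorem mainTheorem5 {k : Type w} [Field k] {H : Type u} [Ring H] [Algebra k H]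
    (Q : QuasiHopfAlgebra k H) (hS : Function.Bijective Q.antipode) :
    ∃ (hR : ∀ V : ModuleCat.{max u v} H, Q.IsYetterDrinfeld (Q.radObj V) (Q.radCoact V))
      (adj : Q.forget ⊣ Q.radFunctor hR),
      (∀ (M : QuasiHopfAlgebra.YetterDrinfeld.{w, u, max u v} Q) (m : M.obj),
        (adj.unit.app M).hom m = Q.toRad M.obj (M.coact m)) ∧
      (∀ (V : ModuleCat.{max u v} H) (a : H) (x : V),
        adj.counit.app V (Q.toRad V (a ⊗ₜ[k] x)) = Q.counit a • x) := by
  exact ⟨fun V => Q.isYetterDrinfeld_radObj V, QuasiHopfAlgebra.forgetRadAdjunction.{w, u, v} Q,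
    fun _ _ => rfl, fun _ _ _ => rfl⟩
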